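/- **Theorem 2 (Degenerate and semi-degenerate Darboux transformation).** Let $(q,r)$, $q,r:\mathbb R^2\to\mathbb C$, be a smooth solution (the seed) of the Kaup–Newell (KN) system $$iq_t-q_{xx}-i(q^2r)_x=0,\qquad ir_t+r_{xx}-i(qr^2)_x=0 .$$ Let $S\subseteq\mathbb C$ be open and let $\Psi=(\phi,\varphi)^{T}(x,t,\lambda)$, $\lambda\in S$, be smooth in $(x,t,\lambda)$, holomorphic in $\lambda$, and satisfy the Lax pair $$\Psi_x=(i\sigma\lambda^2+Q\lambda)\Psi,\qquad \Psi_t=\bigl(2i\sigma\lambda^4+2Q\lambda^3+i\sigma Q^2\lambda^2+(Q^3+iQ_x\sigma)\lambda\bigr)\Psi,$$ $$\sigma=\begin{pmatrix}1&0\\0&-1\end{pmatrix},\qquad Q=\begin{pmatrix}0&q\\ r&0\end{pmatrix}.$$ For $N\ge1$ and $1\le k\le N$ put $$M_k(\lambda)=\begin{cases}\lambda^{N-k}\varphi,&k\text{ odd}\\ \lambda^{N-k}\phi,&k\text{ even,}\end{cases}\qquad P_k(\lambda)=\begin{cases}\lambda^{N-k}\phi,&k\text{ odd}\\ \lambda^{N-k}\varphi,&k\text{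 even,}\end{cases}$$ $$H_k(\lambda)=\begin{cases}\lambda^{N}\phi,&k=1\\ \lambda^{N-k}\phi,&k\text{ even}\\ \lambda^{N-k}\varphi,&k\ge3\text{ odd,}\end{cases}\qquad W_k(\lambda)=\begin{cases}\lambda^{N}\varphi,&k=1\\ \lambda^{N-k}\varphi,&k\text{ even}\\ \lambda^{N-k}\phi,&k\ge3\text{ odd,}\end{cases}$$ where $\phi=\phi(x,t,\lambda)$, $\varphi=\varphi(x,t,\lambda)$. For spectral parameters $\mu_1,\dots,\mu_N$ let $M=(M_k(\mu_j))_{1\le j,k\le N}$, and likewise $P$, $H$. The $N$-fold Darboux transformation (DT) formula is $$q[N]=\frac{|M|^2}{|P|^2}\,q+2i\,\frac{|M||H|}{|P|^2}.$$ Let $n\ge0$ with $2n<N$, and let $\lambda_1,\lambda_2,\dots$ be complex numbers. The *coalesced parameters* are $\lambda_1$ for odd $j\le N-2n$, $\lambda_2$ for even $j\le N-2n$, and $\lambda_j$ for $N-2n<j\le N$; assume that they all lie in $S$. Let $M'$ be the $N\times N$ matrix with the following rows. For $j\le N-2n$ the $(j,k)$ entry is the Taylor coefficient $$\frac{1}{(n_j-1)!}\,\partial_\lambda^{\,n_j-1}M_k(\lambda),\qquad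 n_j=\Bigl[\frac{j+1}{2}\Bigr],$$ at the coalesced parameter of row $j$. For $j>N-2n$ it is $M_k(\lambda_j)$. Define $P',H',W'$ in the same way, and set $$q_N=\frac{|M'|^2}{|P'|^2}\,q+2i\,\frac{|M'||H'|}{|P'|^2},\qquad r_N=\frac{|P'|^2}{|M'|^2}\,r-2i\,\frac{|P'||W'|}{|M'|^2}.$$ 1. *(Limit.)* At every $(x,t)$ with $|P'|\ne0$: there are pairwise distinct $\mu_1,\dots,\mu_N$ arbitrarily close to the coalesced parameters with $\mu_j=\lambda_j$ for $j>N-2n$. As such $\mu$ tend to the coalesced parameters (in any manner), $|P|\neq0$ eventually, and $q[N]\to q_N$. 2. *(Darboux transformation.)* If the coalesced parameters are nonzero, then the set where $|M'||P'|\ne0$ is open, and $(q_N,r_N)$ is a smooth solution of the KN system on it. 3. *(Derivative NLS reduction.)* Suppose in addition that $N$ is even, $r=-q^*$, $S$ is invariant under $\lambda\mapsto-\lambda^*$ with $\phi(x,t,-\lambda^*)^*=\varphi(x,t,\lambda)$ for $\lambda\in S$, $\lambda_2=-\lambda_1^*$, and the set $\{\lambda_j: N-2n<j\le N\}$ is invariant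 under $\lambda\mapsto-\lambda^*$. Then $|M'|\ne0$ and $r_N=-q_N^*$ wherever $|P'|\neq0$. The set where $|P'|\ne0$ is open, and on it $q_N$ is a smooth solution of the derivative nonlinear Schrödinger equation $$iq_t-q_{xx}+i(q^2q^*)_x=0.$$ For the zero seed with $\phi=e^{i(\lambda^2x+2\lambda^4t)}$, $\varphi=e^{-i(\lambda^2x+2\lambda^4t)}$, the solutions $q_N$ of part 3 with $n=0$ (degenerate DT) are called higher-order solitons. Those with $n\ne0$ and $\lambda_j\in i\mathbb R$ for $j>N-2n$ (semi-degenerate DT) are called higher-order solitons on an $n$-periodic background. -/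

import Mathlib

open Topology Filter
open scoped ContDiff ComplexConjugate

noncomputable section

/-! ### The Kaup–Newell system, its reduction, and its Lax pair -/

/-- Partial derivative in `x` of a function of `(x, t)`. -/
def dX (u : ℝ → ℝ → ℂ) (x t : ℝ) : ℂ := deriv (fun y => u y t) x

/-- Partial derivative in `t` of a function of `(x, t)`. -/
def dT (u : ℝ → ℝ → ℂ) (x t : ℝ) : ℂ := deriv (fun s => u x s) t

/-- `u` is smooth on the set `D` of the `(x, t)`-plane. -/
def SmoothOnPlane (D : Set (ℝ × ℝ)) (u : ℝ → ℝ → ℂ) : Prop :=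
  ContDiffOn ℝ ∞ (fun p : ℝ × ℝ => u p.1 p.2) D

/-- `(q, r)` is a smooth solution, on the open set `D`, of the Kaup–Newell system
`i q_t - q_xx - i (q² r)_x = 0`, `i r_t + r_xx - i (q r²)_x = 0`. -/
structure IsKNSolutionOn (D : Set (ℝ × ℝ)) (q r : ℝ → ℝ → ℂ) : Prop where
  isOpen : IsOpen D
  smooth_q : SmoothOnPlane D q
  smooth_r : SmoothOnPlane D r
  eq_q : ∀ x t, (x, t) ∈ D →
    Complex.I * dT q x t - dX (dX q) x t
      - Complex.I * dX (fun y s => q y s ^ 2 * r y s) x t = 0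
  eq_r : ∀ x t, (x, t) ∈ D →
    Complex.I * dT r x t + dX (dX r) x t
      - Complex.I * dX (fun y s => q y s * r y s ^ 2) x t = 0

/-- `q` is a smooth solution, on the open set `D`, of the derivative nonlinear Schrödinger
equation `i q_t - q_xx + i (q² q^*)_x = 0`. -/
structure IsDNLSSolutionOn (D : Set (ℝ × ℝ)) (q : ℝ → ℝ → ℂ) : Prop where
  isOpen : IsOpen D
  smooth : SmoothOnPlane D q
  eq : ∀ x t, (x, t) ∈ D →
    Complex.I * dT q x t - dX (dX q) x t
      + Complex.I * dX (fun y s => q y s ^ 2 * conj (q y s)) x t = 0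

/-- The matrix `σ = diag(1, -1)`. -/
def laxSigma : Matrix (Fin 2) (Fin 2) ℂ := !![1, 0; 0, -1]

/-- The off-diagonal potential matrix. -/
def laxQ (q r : ℂ) : Matrix (Fin 2) (Fin 2) ℂ := !![0, q; r, 0]

/-- `U = iσλ² + Qλ`. -/
def laxU (q r : ℝ → ℝ → ℂ) (x t : ℝ) (z : ℂ) : Matrix (Fin 2) (Fin 2) ℂ :=
  (Complex.I * z ^ 2) • laxSigma + z • laxQ (q x t) (r x t)

/-- `V = 2iσλ⁴ + V₃λ³ + V₂λ² + V₁λ`, with `V₃ = 2Q`, `V₂ = iσQ²`, `V₁ = Q³ + iQ_xσ`. -/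
def laxV (q r : ℝ → ℝ → ℂ) (x t : ℝ) (z : ℂ) : Matrix (Fin 2) (Fin 2) ℂ :=
  (2 * Complex.I * z ^ 4) • laxSigma
    + z ^ 3 • ((2 : ℂ) • laxQ (q x t) (r x t))
    + z ^ 2 • (Complex.I • (laxSigma * laxQ (q x t) (r x t) ^ 2))
    + z • (laxQ (q x t) (r x t) ^ 3
        + Complex.I • (laxQ (dX q x t) (dX r x t) * laxSigma))

/-- `Ψ(x, t, λ) = (φ(x, t, λ), ψ(x, t, λ))ᵀ` is, for `λ` in the open set `S`, a family of
eigenfunctions of the Lax pair `Ψ_x = UΨ`, `Ψ_t = VΨ`, smooth in `(x, t, λ)` and holomorphic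
in `λ`. -/
structure IsEigenfamily (q r : ℝ → ℝ → ℂ) (S : Set ℂ) (φ ψ : ℝ → ℝ → ℂ → ℂ) : Prop where
  isOpen : IsOpen S
  smooth_fst : ContDiffOn ℝ ∞ (fun p : ℝ × ℝ × ℂ => φ p.1 p.2.1 p.2.2) {p | p.2.2 ∈ S}
  smooth_snd : ContDiffOn ℝ ∞ (fun p : ℝ × ℝ × ℂ => ψ p.1 p.2.1 p.2.2) {p | p.2.2 ∈ S}
  holo_fst : ∀ x t, DifferentiableOn ℂ (φ x t) S
  holo_snd : ∀ x t, DifferentiableOn ℂ (ψ x t) S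
  lax_x : ∀ x t, ∀ z ∈ S,
    ![dX (fun y s => φ y s z) x t, dX (fun y s => ψ y s z) x t]
      = Matrix.mulVec (laxU q r x t z) ![φ x t z, ψ x t z]
  lax_t : ∀ x t, ∀ z ∈ S,
    ![dT (fun y s => φ y s z) x t, dT (fun y s => ψ y s z) x t]
      = Matrix.mulVec (laxV q r x t z) ![φ x t z, ψ x t z]

/-! ### The matrices of the `N`-fold Darboux transformation

Rows and columns are counted from `1` in the entry functions below; the index `j : Fin N`
stands for the row (or column) number `j + 1`. In the entry functions `f` and `g` are the two
components of the eigenfunction at a fixed `(x, t)`, as functions of the spectral parameter,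
`k` is the column number, and `z` is the spectral parameter of the row. -/

/-- Entries of `M`: `λ^(N-k) g` for odd `k`, `λ^(N-k) f` for even `k`. -/
def entryM (N : ℕ) (f g : ℂ → ℂ) (k : ℕ) (z : ℂ) : ℂ :=
  if Odd k then z ^ (N - k) * g z else z ^ (N - k) * f z

/-- Entries of `P`: `λ^(N-k) f` for odd `k`, `λ^(N-k) g` for even `k`. -/
def entryP (N : ℕ) (f g : ℂ → ℂ) (k : ℕ) (z : ℂ) : ℂ :=
  if Odd k then z ^ (N - k) * f z else z ^ (N - k) * g z

/-- Entries of `H`: `λ^N f` for `k = 1`, `λ^(N-k) f` for even `k`, `λ^(N-k) g` for odd `k ≥ 3`. -/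
def entryH (N : ℕ) (f g : ℂ → ℂ) (k : ℕ) (z : ℂ) : ℂ :=
  if k = 1 then z ^ N * f z
  else if Odd k then z ^ (N - k) * g z else z ^ (N - k) * f z

/-- Entries of `W`: `λ^N g` for `k = 1`, `λ^(N-k) g` for even `k`, `λ^(N-k) f` for odd `k ≥ 3`. -/
def entryW (N : ℕ) (f g : ℂ → ℂ) (k : ℕ) (z : ℂ) : ℂ :=
  if k = 1 then z ^ N * g z
  else if Odd k then z ^ (N - k) * f z else z ^ (N - k) * g z

/-- The matrix with entry `e k μ_j` in row `j` and column `k`. -/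
def foldMatrix (N : ℕ) (e : ℕ → ℂ → ℂ) (μ : Fin N → ℂ) : Matrix (Fin N) (Fin N) ℂ :=
  Matrix.of fun j k => e (k + 1) (μ j)

/-- The `N`-fold Darboux transformation formula
`q[N] = |M|²/|P|² q + 2i |M||H|/|P|²` with spectral parameters `μ_1, …, μ_N`. -/
def foldQ (N : ℕ) (q : ℝ → ℝ → ℂ) (φ ψ : ℝ → ℝ → ℂ → ℂ) (μ : Fin N → ℂ) (x t : ℝ) : ℂ :=
  (foldMatrix N (entryM N (φ x t) (ψ x t)) μ).det ^ 2
      / (foldMatrix N (entryP N (φ x t) (ψ x t)) μ).det ^ 2 * q x t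
    + 2 * Complex.I * ((foldMatrix N (entryM N (φ x t) (ψ x t)) μ).det
        * (foldMatrix N (entryH N (φ x t) (ψ x t)) μ).det)
      / (foldMatrix N (entryP N (φ x t) (ψ x t)) μ).det ^ 2

/-! ### The degenerate and semi-degenerate Darboux transformation

The spectral parameters are `lam 1, lam 2, …` (the value `lam 0` is never used). -/

/-- The coalesced parameters: `λ_1` in the odd rows `≤ N - 2n`, `λ_2` in the even rows
`≤ N - 2n`, and `λ_j` itself in the last `2n` rows. -/
def coalesced (N n : ℕ) (lam : ℕ → ℂ) (j : Fin N) : ℂ :=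
  if (j : ℕ) + 1 ≤ N - 2 * n then (if Odd ((j : ℕ) + 1) then lam 1 else lam 2)
  else lam (j + 1)

/-- The limit in which pairwise distinct parameters `μ_1, …, μ_N` tend to the coalesced
parameters, the last `2n` of them being kept equal to `λ_{N-2n+1}, …, λ_N`. -/
def coalescence (N n : ℕ) (lam : ℕ → ℂ) : Filter (Fin N → ℂ) :=
  𝓝[{μ | Function.Injective μ ∧ ∀ j : Fin N, N - 2 * n < (j : ℕ) + 1 → μ j = lam (j + 1)}]
    (coalesced N n lam)

/-- `n_j = [(j + 1) / 2]`. -/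
def taylorIndex (j : ℕ) : ℕ := (j + 1) / 2

/-- The degenerate matrix: in each of the first `N - 2n` rows every entry is replaced by its
Taylor coefficient of order `n_j - 1` in the spectral parameter at the coalesced value; the last
`2n` rows are unchanged. -/
def degMatrix (N n : ℕ) (e : ℕ → ℂ → ℂ) (lam : ℕ → ℂ) : Matrix (Fin N) (Fin N) ℂ :=
  Matrix.of fun j k =>
    if (j : ℕ) + 1 ≤ N - 2 * n then
      iteratedDeriv (taylorIndex (j + 1) - 1) (e (k + 1)) (coalesced N n lam j)
        / (Nat.factorial (taylorIndex (j + 1) - 1) : ℂ)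
    else e (k + 1) (lam (j + 1))

/-- `|M'|` at `(x, t)`. -/
def degDetM (N n : ℕ) (φ ψ : ℝ → ℝ → ℂ → ℂ) (lam : ℕ → ℂ) (x t : ℝ) : ℂ :=
  (degMatrix N n (entryM N (φ x t) (ψ x t)) lam).det

/-- `|P'|` at `(x, t)`. -/
def degDetP (N n : ℕ) (φ ψ : ℝ → ℝ → ℂ → ℂ) (lam : ℕ → ℂ) (x t : ℝ) : ℂ :=
  (degMatrix N n (entryP N (φ x t) (ψ x t)) lam).det

/-- `|H'|` at `(x, t)`. -/
def degDetH (N n : ℕ) (φ ψ : ℝ → ℝ → ℂ → ℂ) (lam : ℕ → ℂ) (x t : ℝ) : ℂ :=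
  (degMatrix N n (entryH N (φ x t) (ψ x t)) lam).det

/-- `|W'|` at `(x, t)`. -/
def degDetW (N n : ℕ) (φ ψ : ℝ → ℝ → ℂ → ℂ) (lam : ℕ → ℂ) (x t : ℝ) : ℂ :=
  (degMatrix N n (entryW N (φ x t) (ψ x t)) lam).det

/-- `q_N = |M'|²/|P'|² q + 2i |M'||H'|/|P'|²`. -/
def degQ (N n : ℕ) (q : ℝ → ℝ → ℂ) (φ ψ : ℝ → ℝ → ℂ → ℂ) (lam : ℕ → ℂ) (x t : ℝ) : ℂ :=
  degDetM N n φ ψ lam x t ^ 2 / degDetP N n φ ψ lam x t ^ 2 * q x t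
    + 2 * Complex.I * (degDetM N n φ ψ lam x t * degDetH N n φ ψ lam x t)
      / degDetP N n φ ψ lam x t ^ 2

/-- `r_N = |P'|²/|M'|² r - 2i |P'||W'|/|M'|²`, the companion of `q_N` in the Kaup–Newell
system. -/
def degR (N n : ℕ) (r : ℝ → ℝ → ℂ) (φ ψ : ℝ → ℝ → ℂ → ℂ) (lam : ℕ → ℂ) (x t : ℝ) : ℂ :=
  degDetP N n φ ψ lam x t ^ 2 / degDetM N n φ ψ lam x t ^ 2 * r x t
    - 2 * Complex.I * (degDetP N n φ ψ lam x t * degDetW N n φ ψ lam x t)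
      / degDetM N n φ ψ lam x t ^ 2

end

/-! Write `B` for multiplication by the spectral parameter on the jets `u`, `v` of the two
eigenfunction components at the coalesced parameters. It is triangular, with determinant the product
of these parameters. Differentiation in the parameter commutes with that in `x` and `t`, so `u`, `v`
solve the Lax pair with `B` in place of `λ` (`IsEigenfamily.isMatrixLaxPair`). The Darboux
transformation can thus be done directly at the confluent parameters, without passing through the
limit.

The `N + 1` columns `B ^ (N - k) χ_k` in `ℂ^N`, with `χ_k` alternately `u` and `v`, satisfy Cramer's
linear relation. The minors omitting columns `0` and `1` are `|M'|` and `|H'|` (after exchanging `u`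
and `v`: `|P'|` and `|W'|`); the one omitting the last column is `det B * |P'|`. Divided by `|P'|`,
the relation has coefficients `c_k`, a row of a polynomial Darboux matrix `T` that annihilates the
jets and has constant last coefficient `κ = (-1)^N det B`. Differentiate the relation and subtract
suitable multiples of it: what remains is a combination of `N` independent columns, so every
coefficient vanishes (`coeff_reduction`). These are the intertwining relations `T_x + TU = U₁T` and
`T_t + TV = V₁T`, where `U₁`, `V₁` contain the new potentials.

At `k = N - 1` they read `c_x = κ(Q - s)` and `c_t = κ(W - w)`. Here `Q`, `R` are the new potentials
and `W = Q²R - iQ_x`; `s` is `q` or `r` according to the parity of `N`, and `s_t = w_x` is its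
conservation law. Equality of mixed derivatives gives `Q_t = W_x`
(`IsMatrixLaxPair.potential_evolution`). The second equation follows by exchanging the two
components.

For the limit, one nonsingular triangular matrix turns values at distinct nodes into divided
differences, which tend to Taylor coefficients by Cauchy's formula (`tendsto_sum_nodalWeight_mul`).
Its determinant cancels because the formula is homogeneous of degree zero. For the reduction, `λ ↦
-λ^*` permutes the rows and exchanges `M'` with `P'` and `H'` with `W'` up to conjugation and signs
(`degDet_reflection`). -/

noncomputable section

/-! ### Linear algebra of the Darboux transformation -/

/-- `x` for even `k`, `y` for odd `k`. -/
def alt {α : Type*} (k : ℕ) (x y : α) : α := if Even k then x else y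

theorem alt_zero {α : Type*} (x y : α) : alt 0 x y = x := by simp [alt]

theorem alt_succ {α : Type*} (k : ℕ) (x y : α) : alt (k + 1) x y = alt k y x := by
  by_cases h : Even k <;> simp [alt, h, Nat.even_add_one]

theorem alt_add_two {α : Type*} (k : ℕ) (x y : α) : alt (k + 2) x y = alt k x y := by
  rw [show k + 2 = (k + 1) + 1 from rfl, alt_succ, alt_succ]

variable {N : ℕ}

/-- The `k`-th column `B ^ (N - k) χ` of the extended Darboux matrix, with `χ = u` for even `k`
and `χ = v` for odd `k`. -/
def jetCol (B : Matrix (Fin N) (Fin N) ℂ) (u v : Fin N → ℂ) (k : ℕ) : Fin N → ℂ :=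
  (B ^ (N - k)).mulVec (alt k u v)

/-- The minor of the extended Darboux matrix in which the column `k` is omitted. -/
def colMinor (B : Matrix (Fin N) (Fin N) ℂ) (u v : Fin N → ℂ) (k : ℕ) : ℂ :=
  (Matrix.of fun j i : Fin N => jetCol B u v (if (i : ℕ) < k then i else i + 1) j).det

/-- Cramer's relation among `N + 1` vectors of `ℂ^N`: duplicate the `j`-th row on top of the `N × (N
+ 1)` array and expand the vanishing determinant along it. -/
theorem sum_colMinor_smul_jetCol (B : Matrix (Fin N) (Fin N) ℂ) (u v : Fin N → ℂ) :
    ∑ k ∈ Finset.range (N + 1), ((-1) ^ k * colMinor B u v k) • jetCol B u v k = 0 := by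
  ext j
  rw [Finset.sum_range]
  let F : Matrix (Fin (N + 1)) (Fin (N + 1)) ℂ :=
    Matrix.of fun a k => Fin.cases (jetCol B u v k j) (fun i => jetCol B u v k i) a
  have h0 : F.det = 0 := by
    apply Matrix.det_zero_of_row_eq (i := 0) (j := j.succ) (Fin.succ_ne_zero j).symm
    ext k
    simp [F]
  rw [Matrix.det_succ_row_zero] at h0
  simp only [Finset.sum_apply, Pi.smul_apply, Pi.zero_apply, smul_eq_mul]
  rw [← h0]
  refine Finset.sum_congr rfl fun k _ => ?_
  have h1 : colMinor B u v k = (F.submatrix Fin.succ k.succAbove).det := by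
    unfold colMinor
    congr 1
    ext a b
    have : ((k.succAbove b : Fin (N + 1)) : ℕ) = if (b : ℕ) < k then (b : ℕ) else b + 1 := by
      simp only [Fin.succAbove, Fin.lt_def, Fin.val_castSucc]
      split_ifs <;> simp
    simp [F, this]
  rw [h1]
  simp [F]
  ring

theorem jetCol_eq_mulVec_swap (B : Matrix (Fin N) (Fin N) ℂ) (u v : Fin N → ℂ) {k : ℕ}
    (hk : k < N) : jetCol B u v k = B.mulVec (jetCol B v u (k + 1)) := by
  unfold jetCol
  rw [alt_succ, Matrix.mulVec_mulVec, ← pow_succ', show N - (k + 1) + 1 = N - k by omega]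

/-- Each of the first `N` columns is `B` times the next column of the exchanged system, so a factor
`B` comes out. This is what makes the last normalised coefficient constant. -/
theorem colMinor_last (B : Matrix (Fin N) (Fin N) ℂ) (u v : Fin N → ℂ) :
    colMinor B u v N = B.det * colMinor B v u 0 := by
  unfold colMinor
  rw [← Matrix.det_mul]
  congr 1
  ext j i
  simp [jetCol_eq_mulVec_swap B u v i.2, Matrix.mul_apply, Matrix.mulVec, dotProduct]

theorem eq_zero_of_sum_smul_jetCol {B : Matrix (Fin N) (Fin N) ℂ} {u v : Fin N → ℂ}
    (hP : colMinor B v u 0 ≠ 0) (hB : B.det ≠ 0) (e : ℕ → ℂ)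
    (h : ∑ k ∈ Finset.range N, e k • jetCol B u v k = 0) : ∀ k < N, e k = 0 := by
  have h1 : colMinor B u v N ≠ 0 := by
    rw [colMinor_last]; exact mul_ne_zero hB hP
  have h2 := Matrix.eq_zero_of_mulVec_eq_zero (v := fun i : Fin N => e i) h1 (by
    ext j
    have := congrFun h j
    rw [Finset.sum_range] at this
    simpa [Matrix.mulVec, dotProduct, mul_comm] using this)
  intro k hk
  exact congrFun h2 ⟨k, hk⟩

/-- In a polynomial relation of degree `N + 2`, the two leading terms cancel by `h0` and `h1`, and
the term of order zero by `hg` and the vanishing beyond `N`. The rest involves only the columns `0,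
…, N - 1`, which are independent because their determinant is `det B * |P'|`. -/
theorem coeff_reduction {B : Matrix (Fin N) (Fin N) ℂ} {u v : Fin N → ℂ}
    (hP : colMinor B v u 0 ≠ 0) (hB : B.det ≠ 0) {g a b : ℕ → ℂ}
    (ha : ∀ k, N < k → a k = 0) (hb : ∀ k, N < k → b k = 0)
    (h0 : a 0 = 0) (h1 : a 1 + b 0 = 0) (hg : g N = 0)
    (h : ∑ k ∈ Finset.range (N + 1), (g k • jetCol B u v k
      + a k • (B ^ 2).mulVec (jetCol B u v k) + b k • B.mulVec (jetCol B v u k)) = 0) :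
    ∀ k ≤ N, g k + a (k + 2) + b (k + 1) = 0 := by
  -- The columns renumbered for degree `N + 2`: `B ^ 2` shifts a column by two places, while `B`
  -- together with the exchange of `u` and `v` shifts it by one.
  let Z : ℕ → Fin N → ℂ := fun m => (B ^ (N + 2 - m)).mulVec (alt m u v)
  have hZ2 : ∀ k ≤ N, jetCol B u v k = Z (k + 2) := by
    intro k _
    simp only [Z, jetCol, alt_add_two, show N + 2 - (k + 2) = N - k by omega]
  have hZ0 : ∀ k ≤ N, (B ^ 2).mulVec (jetCol B u v k) = Z k := by
    intro k hk
    simp only [Z, jetCol, Matrix.mulVec_mulVec, ← pow_add, show 2 + (N - k) = N + 2 - k by omega]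
  have hZ1 : ∀ k ≤ N, B.mulVec (jetCol B v u k) = Z (k + 1) := by
    intro k hk
    simp only [Z, jetCol, Matrix.mulVec_mulVec, ← pow_succ', alt_succ,
      show N - k + 1 = N + 2 - (k + 1) by omega]
  have e1 : ∑ k ∈ Finset.range (N + 1), a k • Z k
      = a 1 • Z 1 + ∑ k ∈ Finset.range (N + 1), a (k + 2) • Z (k + 2) := by
    have : ∑ k ∈ Finset.range (N + 1), a k • Z k = ∑ k ∈ Finset.range (N + 1 + 2), a k • Z k := by
      rw [Finset.sum_range_succ _ (N + 2), Finset.sum_range_succ _ (N + 1), ha _ (by omega),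
        ha _ (by omega)]
      simp
    rw [this, Finset.sum_range_succ', Finset.sum_range_succ', h0, zero_smul, add_zero, add_comm]
  have e2 : ∑ k ∈ Finset.range (N + 1), b k • Z (k + 1)
      = b 0 • Z 1 + ∑ k ∈ Finset.range (N + 1), b (k + 1) • Z (k + 2) := by
    have : ∑ k ∈ Finset.range (N + 1), b k • Z (k + 1)
        = ∑ k ∈ Finset.range (N + 1 + 1), b k • Z (k + 1) := by
      rw [Finset.sum_range_succ _ (N + 1), hb _ (by omega)]
      simp
    rw [this, Finset.sum_range_succ', add_comm]
  have e3 : ∑ k ∈ Finset.range (N + 1), (g k + a (k + 2) + b (k + 1)) • jetCol B u v k = 0 := by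
    rw [← h]
    have l : ∀ k ∈ Finset.range (N + 1), (g k + a (k + 2) + b (k + 1)) • jetCol B u v k
        = g k • Z (k + 2) + a (k + 2) • Z (k + 2) + b (k + 1) • Z (k + 2) := by
      intro k hk
      rw [hZ2 k (by simp at hk; omega), add_smul, add_smul]
    have l' : ∀ k ∈ Finset.range (N + 1), (g k • jetCol B u v k
        + a k • (B ^ 2).mulVec (jetCol B u v k) + b k • B.mulVec (jetCol B v u k))
        = g k • Z (k + 2) + a k • Z k + b k • Z (k + 1) := by
      intro k hk
      have hk : k ≤ N := by simp at hk; omega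
      rw [hZ2 k hk, ← hZ0 k hk, ← hZ1 k hk, hZ2 k hk]
    rw [Finset.sum_congr rfl l, Finset.sum_congr rfl l']
    simp only [Finset.sum_add_distrib]
    rw [e1, e2]
    have : a 1 • Z 1 + b 0 • Z 1 = 0 := by rw [← add_smul, h1, zero_smul]
    linear_combination (exp := 1) -this
  have hN : g N + a (N + 2) + b (N + 1) = 0 := by
    rw [hg, ha _ (by omega), hb _ (by omega)]; simp
  rw [Finset.sum_range_succ, hN, zero_smul, add_zero] at e3
  intro k hk
  rcases hk.lt_or_eq with hk | rfl
  · exact eq_zero_of_sum_smul_jetCol hP hB _ e3 k hk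
  · exact hN

theorem jetCol_add (B : Matrix (Fin N) (Fin N) ℂ) (u v u' v' : Fin N → ℂ) (k : ℕ) :
    jetCol B (u + u') (v + v') k = jetCol B u v k + jetCol B u' v' k := by
  by_cases h : Even k <;> simp [jetCol, alt, h, Matrix.mulVec_add]

theorem jetCol_smul_mulVec (B : Matrix (Fin N) (Fin N) ℂ) (s t : ℂ) (m : ℕ) (u v : Fin N → ℂ)
    (k : ℕ) : jetCol B (s • (B ^ m).mulVec u) (t • (B ^ m).mulVec v) k
      = alt k s t • (B ^ m).mulVec (jetCol B u v k) := by
  by_cases h : Even k <;>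
    simp [jetCol, alt, h, Matrix.mulVec_smul, Matrix.mulVec_mulVec, ← pow_add, add_comm]

/-- The differentiated relation minus `iB²` times the relation and `q1 B` times the exchanged
relation has the shape required by `coeff_reduction`. The hypothesis `hq` is exactly the
cancellation of its coefficient of degree `N + 1`. -/
theorem x_coeff_relation {B : Matrix (Fin N) (Fin N) ℂ} {u v : Fin N → ℂ}
    (hP : colMinor B v u 0 ≠ 0) (hB : B.det ≠ 0) {c d c' : ℕ → ℂ} {i q r q1 : ℂ}
    (hc : ∀ k, N < k → c k = 0) (hd : ∀ k, N < k → d k = 0)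
    (hcs : ∑ k ∈ Finset.range (N + 1), c k • jetCol B u v k = 0)
    (hds : ∑ k ∈ Finset.range (N + 1), d k • jetCol B v u k = 0)
    (hc' : c' N = 0) (hq : q1 * d 0 = q * c 0 - 2 * i * c 1)
    (h : ∑ k ∈ Finset.range (N + 1), (c' k • jetCol B u v k
      + c k • jetCol B (i • (B ^ 2).mulVec u + q • (B ^ 1).mulVec v)
        ((-i) • (B ^ 2).mulVec v + r • (B ^ 1).mulVec u) k) = 0) :
    ∀ k ≤ N, c' k + (alt k i (-i) - i) * c (k + 2) + (alt k r q * c (k + 1) - q1 * d (k + 1))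
      = 0 := by
  have := coeff_reduction (g := c') (a := fun k => (alt k i (-i) - i) * c k)
    (b := fun k => alt k q r * c k - q1 * d k) hP hB
    (fun k hk => by simp [hc k hk]) (fun k hk => by simp [hc k hk, hd k hk])
    (by simp [alt_zero]) (by
      simp only [alt_succ 0, alt_zero]
      linear_combination -hq) hc' (by
      have e1 : i • (B ^ 2).mulVec (∑ k ∈ Finset.range (N + 1), c k • jetCol B u v k) = 0 := by
        rw [hcs]; simp
      have e2 : q1 • B.mulVec (∑ k ∈ Finset.range (N + 1), d k • jetCol B v u k) = 0 := by
        rw [hds]; simp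
      rw [Matrix.mulVec_sum, Finset.smul_sum] at e1 e2
      have h' := congrArg₂ (· - ·) (congrArg₂ (· - ·) h e1) e2
      simp only [sub_zero, ← Finset.sum_sub_distrib] at h'
      refine Eq.trans ?_ h'
      refine Finset.sum_congr rfl fun k _ => ?_
      rw [jetCol_add, jetCol_smul_mulVec, jetCol_smul_mulVec, pow_one, Matrix.mulVec_smul,
        Matrix.mulVec_smul]
      module)
  intro k hk
  simpa only [alt_add_two, alt_succ] using this k hk

theorem t_coeff_relation {B : Matrix (Fin N) (Fin N) ℂ} {u v : Fin N → ℂ}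
    (hP : colMinor B v u 0 ≠ 0) (hB : B.det ≠ 0) {c d c' cdot : ℕ → ℂ}
    {i q r q1 r1 w w' w1 : ℂ}
    (hc : ∀ k, N < k → c k = 0) (hd : ∀ k, N < k → d k = 0) (hc'0 : ∀ k, N < k → c' k = 0)
    (hcs : ∑ k ∈ Finset.range (N + 1), c k • jetCol B u v k = 0)
    (hds : ∑ k ∈ Finset.range (N + 1), d k • jetCol B v u k = 0)
    (hcdot : cdot N = 0)
    (h0 : -2 * c' 0 + i * (q * r - q1 * r1) * c 0 = 0)
    (h1 : -2 * c' 1 + i * (-(q * r) - q1 * r1) * c 1 + (w * c 0 - w1 * d 0) = 0)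
    (hx : ∑ k ∈ Finset.range (N + 1), (c' k • jetCol B u v k
      + c k • jetCol B (i • (B ^ 2).mulVec u + q • (B ^ 1).mulVec v)
        ((-i) • (B ^ 2).mulVec v + r • (B ^ 1).mulVec u) k) = 0)
    (ht : ∑ k ∈ Finset.range (N + 1), (cdot k • jetCol B u v k
      + c k • jetCol B
        ((2 * i) • (B ^ 4).mulVec u + (2 * q) • (B ^ 3).mulVec v
          + (i * (q * r)) • (B ^ 2).mulVec u + w • (B ^ 1).mulVec v)
        ((2 * -i) • (B ^ 4).mulVec v + (2 * r) • (B ^ 3).mulVec u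
          + (-i * (q * r)) • (B ^ 2).mulVec v + w' • (B ^ 1).mulVec u) k) = 0) :
    ∀ k ≤ N, cdot k + (-2 * c' (k + 2) + i * (alt k (q * r) (-(q * r)) - q1 * r1) * c (k + 2))
      + (alt k w' w * c (k + 1) - w1 * d (k + 1)) = 0 := by
  have := coeff_reduction (g := cdot)
    (a := fun k => -2 * c' k + i * (alt k (q * r) (-(q * r)) - q1 * r1) * c k)
    (b := fun k => alt k w w' * c k - w1 * d k) hP hB
    (fun k hk => by simp [hc k hk, hc'0 k hk]) (fun k hk => by simp [hc k hk, hd k hk])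
    (by simpa only [alt_zero] using h0) (by simpa only [alt_succ 0, alt_zero] using h1) hcdot (by
      have e1 : (i * (q1 * r1)) • (B ^ 2).mulVec
          (∑ k ∈ Finset.range (N + 1), c k • jetCol B u v k) = 0 := by
        rw [hcs]; simp
      have e2 : w1 • B.mulVec (∑ k ∈ Finset.range (N + 1), d k • jetCol B v u k) = 0 := by
        rw [hds]; simp
      -- Since `V - 2λ²U` is quadratic in `λ`, subtracting `2B²` times the `x`-relation removes the
      -- terms in `B ^ 4` and `B ^ 3`, at the cost of the terms `-2 * c' k`.
      have e3 := congrArg (fun z => (2 : ℂ) • (B ^ 2).mulVec z) hx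
      simp only [Matrix.mulVec_zero, smul_zero] at e3
      rw [Matrix.mulVec_sum, Finset.smul_sum] at e1 e2 e3
      have ht' := congrArg₂ (· - ·) (congrArg₂ (· - ·) (congrArg₂ (· - ·) ht e1) e2) e3
      simp only [sub_zero, ← Finset.sum_sub_distrib] at ht'
      refine Eq.trans ?_ ht'
      refine Finset.sum_congr rfl fun k _ => ?_
      have p4 : ∀ z, (B ^ 4).mulVec z = (B ^ 2).mulVec ((B ^ 2).mulVec z) := fun z => by
        rw [Matrix.mulVec_mulVec, ← pow_add]
      have p3 : ∀ z, (B ^ 3).mulVec z = (B ^ 2).mulVec (B.mulVec z) := fun z => by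
        rw [Matrix.mulVec_mulVec, ← pow_succ]
      simp only [jetCol_add, jetCol_smul_mulVec]
      simp only [Matrix.mulVec_smul, Matrix.mulVec_add, pow_one, p4, p3]
      by_cases hk : Even k <;> simp only [alt, hk, if_true, if_false] <;> module)
  intro k hk
  simpa only [alt_add_two, alt_succ] using this k hk

end

noncomputable section

/-! ### Partial derivatives on the plane -/

section Plane

variable {D : Set (ℝ × ℝ)} {f g : ℝ → ℝ → ℂ} {x t : ℝ}

theorem contDiffOn_complex_div {E : Type*} [NormedAddCommGroup E] [NormedSpace ℝ E] {s : Set E}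
    {F G : E → ℂ} (hF : ContDiffOn ℝ ∞ F s) (hG : ContDiffOn ℝ ∞ G s) (h : ∀ p ∈ s, G p ≠ 0) :
    ContDiffOn ℝ ∞ (fun p => F p / G p) s := by
  simp only [div_eq_mul_inv]
  exact hF.mul (hG.inv h)

theorem SmoothOnPlane.contDiffAt (hf : SmoothOnPlane D f) (hD : IsOpen D) (h : (x, t) ∈ D) :
    ContDiffAt ℝ ∞ (fun p : ℝ × ℝ => f p.1 p.2) (x, t) :=
  ContDiffOn.contDiffAt hf (hD.mem_nhds h)

theorem SmoothOnPlane.differentiableAt (hf : SmoothOnPlane D f) (hD : IsOpen D)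
    (h : (x, t) ∈ D) : DifferentiableAt ℝ (fun p : ℝ × ℝ => f p.1 p.2) (x, t) :=
  (hf.contDiffAt hD h).differentiableAt (by simp)

theorem hasDerivAt_fst_of_differentiableAt {E : Type*} [NormedAddCommGroup E] [NormedSpace ℝ E]
    {F : ℝ × ℝ → E} (h : DifferentiableAt ℝ F (x, t)) :
    HasDerivAt (fun y => F (y, t)) (fderiv ℝ F (x, t) (1, 0)) x := by
  have := h.hasFDerivAt.comp_hasDerivAt x ((hasDerivAt_id x).prodMk (hasDerivAt_const x t))
  exact this

theorem hasDerivAt_snd_of_differentiableAt {E : Type*} [NormedAddCommGroup E] [NormedSpace ℝ E]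
    {F : ℝ × ℝ → E} (h : DifferentiableAt ℝ F (x, t)) :
    HasDerivAt (fun s => F (x, s)) (fderiv ℝ F (x, t) (0, 1)) t := by
  have := h.hasFDerivAt.comp_hasDerivAt t ((hasDerivAt_const t x).prodMk (hasDerivAt_id t))
  exact this

theorem SmoothOnPlane.dX_eq (hf : SmoothOnPlane D f) (hD : IsOpen D) (h : (x, t) ∈ D) :
    dX f x t = fderiv ℝ (fun p : ℝ × ℝ => f p.1 p.2) (x, t) (1, 0) :=
  (hasDerivAt_fst_of_differentiableAt (hf.differentiableAt hD h)).deriv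

theorem SmoothOnPlane.dT_eq (hf : SmoothOnPlane D f) (hD : IsOpen D) (h : (x, t) ∈ D) :
    dT f x t = fderiv ℝ (fun p : ℝ × ℝ => f p.1 p.2) (x, t) (0, 1) :=
  (hasDerivAt_snd_of_differentiableAt (hf.differentiableAt hD h)).deriv

theorem SmoothOnPlane.hasDerivAt_dX (hf : SmoothOnPlane D f) (hD : IsOpen D) (h : (x, t) ∈ D) :
    HasDerivAt (fun y => f y t) (dX f x t) x := by
  rw [hf.dX_eq hD h]
  exact hasDerivAt_fst_of_differentiableAt (hf.differentiableAt hD h)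

theorem SmoothOnPlane.hasDerivAt_dT (hf : SmoothOnPlane D f) (hD : IsOpen D) (h : (x, t) ∈ D) :
    HasDerivAt (fun s => f x s) (dT f x t) t := by
  rw [hf.dT_eq hD h]
  exact hasDerivAt_snd_of_differentiableAt (hf.differentiableAt hD h)

theorem SmoothOnPlane.fderiv_apply (hf : SmoothOnPlane D f) (hD : IsOpen D) (w : ℝ × ℝ) :
    ContDiffOn ℝ ∞ (fun p => fderiv ℝ (fun p : ℝ × ℝ => f p.1 p.2) p w) D :=
  (ContDiffOn.fderiv_of_isOpen hf hD (by simp)).clm_apply contDiffOn_const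

theorem SmoothOnPlane.dX (hf : SmoothOnPlane D f) (hD : IsOpen D) : SmoothOnPlane D (dX f) :=
  (hf.fderiv_apply hD (1, 0)).congr fun _ hp => hf.dX_eq hD hp

theorem SmoothOnPlane.dT (hf : SmoothOnPlane D f) (hD : IsOpen D) : SmoothOnPlane D (dT f) :=
  (hf.fderiv_apply hD (0, 1)).congr fun _ hp => hf.dT_eq hD hp

theorem eventually_mem_fst (hD : IsOpen D) (h : (x, t) ∈ D) : ∀ᶠ y in 𝓝 x, (y, t) ∈ D :=
  (Continuous.prodMk_left t).continuousAt.eventually (hD.mem_nhds h)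

theorem eventually_mem_snd (hD : IsOpen D) (h : (x, t) ∈ D) : ∀ᶠ s in 𝓝 t, (x, s) ∈ D :=
  (Continuous.prodMk_right x).continuousAt.eventually (hD.mem_nhds h)

theorem dX_congr (hD : IsOpen D) (hfg : ∀ x t, (x, t) ∈ D → f x t = g x t) (h : (x, t) ∈ D) :
    dX f x t = dX g x t :=
  Filter.EventuallyEq.deriv_eq ((eventually_mem_fst hD h).mono fun _ hy => hfg _ _ hy)

theorem dT_congr (hD : IsOpen D) (hfg : ∀ x t, (x, t) ∈ D → f x t = g x t) (h : (x, t) ∈ D) :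
    dT f x t = dT g x t :=
  Filter.EventuallyEq.deriv_eq ((eventually_mem_snd hD h).mono fun _ hy => hfg _ _ hy)

theorem SmoothOnPlane.dT_dX (hf : SmoothOnPlane D f) (hD : IsOpen D) (h : (x, t) ∈ D) :
    _root_.dT (_root_.dX f) x t = _root_.dX (_root_.dT f) x t := by
  set F : ℝ × ℝ → ℂ := fun p => f p.1 p.2 with hF
  have hd : DifferentiableAt ℝ (fderiv ℝ F) (x, t) :=
    ((hf.contDiffAt hD h).fderiv_right (m := 1) (WithTop.coe_le_coe.2 le_top)).differentiableAt
      one_ne_zero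
  have h1 : HasDerivAt (fun s => fderiv ℝ F (x, s)) (fderiv ℝ (fderiv ℝ F) (x, t) (0, 1)) t :=
    hasDerivAt_snd_of_differentiableAt hd
  have h2 : HasDerivAt (fun y => fderiv ℝ F (y, t)) (fderiv ℝ (fderiv ℝ F) (x, t) (1, 0)) x :=
    hasDerivAt_fst_of_differentiableAt hd
  have e1 : _root_.dT (_root_.dX f) x t = fderiv ℝ (fderiv ℝ F) (x, t) (0, 1) (1, 0) := by
    rw [dT_congr (g := fun x t => fderiv ℝ F (x, t) (1, 0)) hD (fun x t h => hf.dX_eq hD h) h,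
      _root_.dT, (h1.clm_apply (hasDerivAt_const t ((1, 0) : ℝ × ℝ))).deriv]
    simp
  have e2 : _root_.dX (_root_.dT f) x t = fderiv ℝ (fderiv ℝ F) (x, t) (1, 0) (0, 1) := by
    rw [dX_congr (g := fun x t => fderiv ℝ F (x, t) (0, 1)) hD (fun x t h => hf.dT_eq hD h) h,
      _root_.dX, (h2.clm_apply (hasDerivAt_const x ((0, 1) : ℝ × ℝ))).deriv]
    simp
  have hF2 : ContDiffAt ℝ ∞ F (x, t) := hf.contDiffAt hD h
  have hsymm : IsSymmSndFDerivAt ℝ F (x, t) := hF2.isSymmSndFDerivAt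
    (by rw [minSmoothness_of_isRCLikeNormedField]; exact WithTop.coe_le_coe.2 le_top)
  rw [e1, e2, hsymm.eq]

end Plane

/-! ### Darboux transformation of a pair of vectors solving a matrix Lax pair -/

variable {N : ℕ}

/-- `u` and `v` solve the Lax pair in which the spectral parameter is the matrix `B`, and
`i` is a square root of `-1`. -/
structure IsMatrixLaxPair (B : Matrix (Fin N) (Fin N) ℂ) (i : ℂ) (q r : ℝ → ℝ → ℂ)
    (u v : ℝ → ℝ → Fin N → ℂ) : Prop where
  smooth_fst : ContDiff ℝ ∞ fun p : ℝ × ℝ => u p.1 p.2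
  smooth_snd : ContDiff ℝ ∞ fun p : ℝ × ℝ => v p.1 p.2
  fst_x : ∀ x t, HasDerivAt (fun y => u y t)
    (i • (B ^ 2).mulVec (u x t) + q x t • (B ^ 1).mulVec (v x t)) x
  snd_x : ∀ x t, HasDerivAt (fun y => v y t)
    (-i • (B ^ 2).mulVec (v x t) + r x t • (B ^ 1).mulVec (u x t)) x
  fst_t : ∀ x t, HasDerivAt (fun s => u x s)
    ((2 * i) • (B ^ 4).mulVec (u x t) + (2 * q x t) • (B ^ 3).mulVec (v x t)
      + (i * (q x t * r x t)) • (B ^ 2).mulVec (u x t)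
      + (q x t ^ 2 * r x t - i * dX q x t) • (B ^ 1).mulVec (v x t)) t
  snd_t : ∀ x t, HasDerivAt (fun s => v x s)
    ((2 * -i) • (B ^ 4).mulVec (v x t) + (2 * r x t) • (B ^ 3).mulVec (u x t)
      + (-i * (q x t * r x t)) • (B ^ 2).mulVec (v x t)
      + (r x t ^ 2 * q x t + i * dX r x t) • (B ^ 1).mulVec (u x t)) t

/-- The exchange of the components sends `i` to `-i`; keeping `i` a variable lets each result about
`q` yield its counterpart for `r`. -/
theorem IsMatrixLaxPair.symm {B : Matrix (Fin N) (Fin N) ℂ} {i : ℂ} {q r : ℝ → ℝ → ℂ}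
    {u v : ℝ → ℝ → Fin N → ℂ} (h : IsMatrixLaxPair B i q r u v) :
    IsMatrixLaxPair B (-i) r q v u where
  smooth_fst := h.smooth_snd
  smooth_snd := h.smooth_fst
  fst_x := h.snd_x
  snd_x := by simpa using h.fst_x
  fst_t := by simpa [mul_comm (r _ _) (q _ _)] using h.snd_t
  snd_t := by simpa [mul_comm (r _ _) (q _ _), sub_eq_add_neg] using h.fst_t

/-- The coefficients of a polynomial row vector annihilating the jets, the coefficient of order
zero being `(-1) ^ N * B.det`. -/
def dtCoeff (B : Matrix (Fin N) (Fin N) ℂ) (u v : Fin N → ℂ) (k : ℕ) : ℂ :=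
  if k ≤ N then (-1) ^ k * colMinor B u v k / colMinor B v u 0 else 0

/-- The transformed potential. -/
def dtPotential (B : Matrix (Fin N) (Fin N) ℂ) (i q : ℂ) (u v : Fin N → ℂ) : ℂ :=
  colMinor B u v 0 ^ 2 / colMinor B v u 0 ^ 2 * q
    + 2 * i * (colMinor B u v 0 * colMinor B u v 1) / colMinor B v u 0 ^ 2

theorem sum_dtCoeff_smul_jetCol (B : Matrix (Fin N) (Fin N) ℂ) (u v : Fin N → ℂ) :
    ∑ k ∈ Finset.range (N + 1), dtCoeff B u v k • jetCol B u v k = 0 := by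
  have := congrArg (fun z => (colMinor B v u 0)⁻¹ • z) (sum_colMinor_smul_jetCol B u v)
  simp only [smul_zero, Finset.smul_sum] at this
  rw [← this]
  refine Finset.sum_congr rfl fun k hk => ?_
  rw [dtCoeff, if_pos (by simp at hk; omega), smul_smul]
  congr 1
  ring

theorem dtCoeff_eq_zero (B : Matrix (Fin N) (Fin N) ℂ) (u v : Fin N → ℂ) {k : ℕ} (hk : N < k) :
    dtCoeff B u v k = 0 := by
  rw [dtCoeff, if_neg (by omega)]

theorem dtCoeff_last {B : Matrix (Fin N) (Fin N) ℂ} {u v : Fin N → ℂ}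
    (h : colMinor B v u 0 ≠ 0) : dtCoeff B u v N = (-1) ^ N * B.det := by
  rw [dtCoeff, if_pos le_rfl, colMinor_last]
  field_simp

/-- The formula for the new potential is the solution of this linear equation, the leading
nontrivial condition in `T_x + TU = U₁T`. -/
theorem dtPotential_mul_dtCoeff (hN : 0 < N) {B : Matrix (Fin N) (Fin N) ℂ} {u v : Fin N → ℂ}
    (hP : colMinor B v u 0 ≠ 0) (hM : colMinor B u v 0 ≠ 0) (i q : ℂ) :
    dtPotential B i q u v * dtCoeff B v u 0 = q * dtCoeff B u v 0 - 2 * i * dtCoeff B u v 1 := by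
  rw [dtCoeff, dtCoeff, dtCoeff, if_pos (Nat.zero_le N), if_pos (Nat.zero_le N),
    if_pos (Nat.succ_le_of_lt hN), dtPotential]
  field_simp
  ring

theorem contDiff_colMinor (B : Matrix (Fin N) (Fin N) ℂ) {u v : ℝ → ℝ → Fin N → ℂ}
    (hu : ContDiff ℝ ∞ fun p : ℝ × ℝ => u p.1 p.2) (hv : ContDiff ℝ ∞ fun p : ℝ × ℝ => v p.1 p.2)
    (k : ℕ) : ContDiff ℝ ∞ fun p : ℝ × ℝ => colMinor B (u p.1 p.2) (v p.1 p.2) k := by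
  have hcol : ∀ k j, ContDiff ℝ ∞ fun p : ℝ × ℝ => jetCol B (u p.1 p.2) (v p.1 p.2) k j := by
    intro k j
    rw [contDiff_pi] at hu hv
    unfold jetCol
    by_cases h : Even k <;> simp only [alt, h, if_true, if_false, Matrix.mulVec, dotProduct]
    · exact ContDiff.sum fun l _ => contDiff_const.mul (hu l)
    · exact ContDiff.sum fun l _ => contDiff_const.mul (hv l)
  unfold colMinor
  simp only [Matrix.det_apply', Matrix.of_apply]
  exact ContDiff.sum fun s _ => contDiff_const.mul (contDiff_prod fun l _ => hcol _ _)

theorem hasDerivAt_mulVec (A : Matrix (Fin N) (Fin N) ℂ) {w : ℝ → Fin N → ℂ} {w' : Fin N → ℂ}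
    {s : ℝ} (h : HasDerivAt w w' s) :
    HasDerivAt (fun s => A.mulVec (w s)) (A.mulVec w') s := by
  rw [hasDerivAt_pi] at h ⊢
  intro j
  simp only [Matrix.mulVec, dotProduct]
  exact HasDerivAt.fun_sum fun l _ => (h l).const_mul (A j l)

theorem hasDerivAt_jetCol (B : Matrix (Fin N) (Fin N) ℂ) {u v : ℝ → Fin N → ℂ}
    {u' v' : Fin N → ℂ} {s : ℝ} (hu : HasDerivAt u u' s) (hv : HasDerivAt v v' s) (k : ℕ) :
    HasDerivAt (fun s => jetCol B (u s) (v s) k) (jetCol B u' v' k) s := by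
  unfold jetCol
  by_cases h : Even k <;> simp only [alt, h, if_true, if_false]
  · exact hasDerivAt_mulVec _ hu
  · exact hasDerivAt_mulVec _ hv

theorem sum_deriv_smul_jetCol {B : Matrix (Fin N) (Fin N) ℂ} {u v : ℝ → Fin N → ℂ}
    {u' v' : Fin N → ℂ} {s : ℝ} (hu : HasDerivAt u u' s) (hv : HasDerivAt v v' s)
    {c' : ℕ → ℂ} (hc : ∀ k, HasDerivAt (fun s => dtCoeff B (u s) (v s) k) (c' k) s) :
    ∑ k ∈ Finset.range (N + 1), (c' k • jetCol B (u s) (v s) k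
      + dtCoeff B (u s) (v s) k • jetCol B u' v' k) = 0 := by
  have h1 : HasDerivAt (fun s => ∑ k ∈ Finset.range (N + 1),
      dtCoeff B (u s) (v s) k • jetCol B (u s) (v s) k)
      (∑ k ∈ Finset.range (N + 1), (dtCoeff B (u s) (v s) k • jetCol B u' v' k
        + c' k • jetCol B (u s) (v s) k)) s :=
    HasDerivAt.fun_sum fun k _ => (hc k).fun_smul (hasDerivAt_jetCol B hu hv k)
  -- The relation holds even where the denominator vanishes, as all coefficients are then `0`. The
  -- differentiated function is therefore identically zero.
  simp only [sum_dtCoeff_smul_jetCol] at h1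
  rw [← h1.unique (hasDerivAt_const s 0)]
  exact Finset.sum_congr rfl fun k _ => add_comm _ _

/-- The set on which the two leading minors do not vanish. -/
def dtDomain (B : Matrix (Fin N) (Fin N) ℂ) (u v : ℝ → ℝ → Fin N → ℂ) : Set (ℝ × ℝ) :=
  {p | colMinor B (u p.1 p.2) (v p.1 p.2) 0 ≠ 0 ∧ colMinor B (v p.1 p.2) (u p.1 p.2) 0 ≠ 0}

theorem dtDomain_symm (B : Matrix (Fin N) (Fin N) ℂ) (u v : ℝ → ℝ → Fin N → ℂ) :
    dtDomain B v u = dtDomain B u v := by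
  ext p
  exact and_comm

/-! ### Intertwining relations and the evolution of the new potential. -/

namespace IsMatrixLaxPair

variable {B : Matrix (Fin N) (Fin N) ℂ} {i : ℂ} {q r : ℝ → ℝ → ℂ} {u v : ℝ → ℝ → Fin N → ℂ}

theorem isOpen_dtDomain (h : IsMatrixLaxPair B i q r u v) : IsOpen (dtDomain B u v) :=
  ((contDiff_colMinor B h.smooth_fst h.smooth_snd 0).continuous.isOpen_preimage _
    isOpen_ne).inter ((contDiff_colMinor B h.smooth_snd h.smooth_fst 0).continuous.isOpen_preimage _
    isOpen_ne)

theorem smooth_dtCoeff (h : IsMatrixLaxPair B i q r u v) (k : ℕ) :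
    SmoothOnPlane (dtDomain B u v) fun x t => dtCoeff B (u x t) (v x t) k := by
  by_cases hk : k ≤ N
  · simp only [dtCoeff, hk, if_true]
    exact contDiffOn_complex_div
      (contDiff_const.mul (contDiff_colMinor B h.smooth_fst h.smooth_snd k)).contDiffOn
      (contDiff_colMinor B h.smooth_snd h.smooth_fst 0).contDiffOn fun p hp => hp.2
  · simp only [dtCoeff, hk, if_false]
    exact contDiffOn_const

theorem smooth_dtPotential (h : IsMatrixLaxPair B i q r u v) (hq : SmoothOnPlane Set.univ q)
    (j : ℂ) :
    SmoothOnPlane (dtDomain B u v) fun x t => dtPotential B j (q x t) (u x t) (v x t) := by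
  have hM := (contDiff_colMinor B h.smooth_fst h.smooth_snd 0).contDiffOn (s := dtDomain B u v)
  have hH := (contDiff_colMinor B h.smooth_fst h.smooth_snd 1).contDiffOn (s := dtDomain B u v)
  have hP := (contDiff_colMinor B h.smooth_snd h.smooth_fst 0).contDiffOn (s := dtDomain B u v)
  have hP2 : ∀ p ∈ dtDomain B u v, colMinor B (v p.1 p.2) (u p.1 p.2) 0 ^ 2 ≠ 0 :=
    fun p hp => pow_ne_zero 2 hp.2
  exact ((contDiffOn_complex_div (hM.pow 2) (hP.pow 2) hP2).mul
    (ContDiffOn.mono hq (Set.subset_univ _))).add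
    (contDiffOn_complex_div (contDiffOn_const.mul (hM.mul hH)) (hP.pow 2) hP2)

/-- The first row of `T_x + TU = U₁T`, coefficient by coefficient; even `k` gives the first entry
and odd `k` the second. -/
theorem x_relation (h : IsMatrixLaxPair B i q r u v) (hN : 0 < N) (hB : B.det ≠ 0) {x t : ℝ}
    (hp : (x, t) ∈ dtDomain B u v) :
    ∀ k ≤ N, dX (fun x t => dtCoeff B (u x t) (v x t) k) x t
      + (alt k i (-i) - i) * dtCoeff B (u x t) (v x t) (k + 2)
      + (alt k (r x t) (q x t) * dtCoeff B (u x t) (v x t) (k + 1)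
        - dtPotential B i (q x t) (u x t) (v x t) * dtCoeff B (v x t) (u x t) (k + 1)) = 0 := by
  refine x_coeff_relation hp.2 hB
    (c := dtCoeff B (u x t) (v x t)) (d := dtCoeff B (v x t) (u x t))
    (c' := fun k => dX (fun x t => dtCoeff B (u x t) (v x t) k) x t)
    (fun k hk => dtCoeff_eq_zero _ _ _ hk)
    (fun k hk => dtCoeff_eq_zero _ _ _ hk) (sum_dtCoeff_smul_jetCol _ _ _)
    (sum_dtCoeff_smul_jetCol _ _ _) ?_ (dtPotential_mul_dtCoeff hN hp.2 hp.1 i (q x t))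
    (sum_deriv_smul_jetCol (h.fst_x x t) (h.snd_x x t)
      fun k => (h.smooth_dtCoeff k).hasDerivAt_dX h.isOpen_dtDomain hp)
  rw [dX_congr (g := fun _ _ => (-1) ^ N * B.det) h.isOpen_dtDomain
    (fun x t hp => dtCoeff_last hp.2) hp]
  simp [dX]

/-- The first row of `T_t + TV = V₁T`. The two leading cancellations follow from the `x`-relations
at `k = 0` for both orders of the components, the equations defining the new potentials, and the
`x`-derivative of the first of these. -/
theorem t_relation (h : IsMatrixLaxPair B i q r u v) (hi : i ^ 2 = -1) (hN : 0 < N)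
    (hB : B.det ≠ 0) (hqs : SmoothOnPlane Set.univ q) {x t : ℝ} (hp : (x, t) ∈ dtDomain B u v) :
    ∀ k ≤ N, dT (fun x t => dtCoeff B (u x t) (v x t) k) x t
      + (-2 * dX (fun x t => dtCoeff B (u x t) (v x t) (k + 2)) x t
        + i * (alt k (q x t * r x t) (-(q x t * r x t))
          - dtPotential B i (q x t) (u x t) (v x t) * dtPotential B (-i) (r x t) (v x t) (u x t))
          * dtCoeff B (u x t) (v x t) (k + 2))
      + (alt k (r x t ^ 2 * q x t + i * dX r x t) (q x t ^ 2 * r x t - i * dX q x t)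
          * dtCoeff B (u x t) (v x t) (k + 1)
        - (dtPotential B i (q x t) (u x t) (v x t) ^ 2 * dtPotential B (-i) (r x t) (v x t) (u x t)
          - i * dX (fun x t => dtPotential B i (q x t) (u x t) (v x t)) x t)
          * dtCoeff B (v x t) (u x t) (k + 1)) = 0 := by
  have hD := h.isOpen_dtDomain
  have hp' : (x, t) ∈ dtDomain B v u := by rwa [dtDomain_symm]
  have hds : ∀ k, SmoothOnPlane (dtDomain B u v) fun x t => dtCoeff B (v x t) (u x t) k := by
    intro k
    have := h.symm.smooth_dtCoeff k
    rwa [dtDomain_symm] at this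
  have hdx : ∀ k, HasDerivAt (fun y => dtCoeff B (u y t) (v y t) k)
      (dX (fun x t => dtCoeff B (u x t) (v x t) k) x t) x :=
    fun k => (h.smooth_dtCoeff k).hasDerivAt_dX hD hp
  have hx0 := h.x_relation hN hB hp 0 (Nat.zero_le N)
  have hx0' := h.symm.x_relation hN hB hp' 0 (Nat.zero_le N)
  simp only [alt_zero, sub_self, zero_mul, add_zero, zero_add] at hx0 hx0'
  have hq := dtPotential_mul_dtCoeff hN hp.2 hp.1 i (q x t)
  have hr := dtPotential_mul_dtCoeff hN hp.1 hp.2 (-i) (r x t)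
  -- The equation for the new potential holds on a neighbourhood, so it may be differentiated in
  -- `x`; this relates the `x`-derivative of the new potential to those of the coefficients.
  have hqx := ((((h.smooth_dtPotential hqs i).hasDerivAt_dX hD hp).mul
    ((hds 0).hasDerivAt_dX hD hp)).congr_of_eventuallyEq
      ((eventually_mem_fst hD hp).mono fun y hy =>
        (dtPotential_mul_dtCoeff hN hy.2 hy.1 i (q y t)).symm)).unique
    (((hqs.hasDerivAt_dX isOpen_univ (Set.mem_univ (x, t))).mul (hdx 0)).sub
      ((hdx 1).const_mul (2 * i)))
  refine t_coeff_relation hp.2 hB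
    (c := dtCoeff B (u x t) (v x t)) (d := dtCoeff B (v x t) (u x t))
    (c' := fun k => dX (fun x t => dtCoeff B (u x t) (v x t) k) x t)
    (cdot := fun k => dT (fun x t => dtCoeff B (u x t) (v x t) k) x t)
    (fun k hk => dtCoeff_eq_zero _ _ _ hk)
    (fun k hk => dtCoeff_eq_zero _ _ _ hk)
    (fun k hk => by simp [dtCoeff_eq_zero _ _ _ hk, dX])
    (sum_dtCoeff_smul_jetCol _ _ _) (sum_dtCoeff_smul_jetCol _ _ _) ?_ ?_ ?_
    (sum_deriv_smul_jetCol (h.fst_x x t) (h.snd_x x t) hdx)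
    (sum_deriv_smul_jetCol (h.fst_t x t) (h.snd_t x t)
      fun k => (h.smooth_dtCoeff k).hasDerivAt_dT hD hp)
  · rw [dT_congr (g := fun _ _ => (-1) ^ N * B.det) hD (fun x t hp => dtCoeff_last hp.2) hp]
    simp [dT]
  · linear_combination (-2 : ℂ) * hx0 - i * dtPotential B i (q x t) (u x t) (v x t) * hr
      - i * r x t * hq - 2 * (dtPotential B i (q x t) (u x t) (v x t) * dtCoeff B (v x t) (u x t) 1
        - r x t * dtCoeff B (u x t) (v x t) 1) * hi
  · linear_combination i * hqx - i * dtPotential B i (q x t) (u x t) (v x t) * hx0'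
      + i * q x t * hx0 - q x t * r x t * hq
      - dtPotential B i (q x t) (u x t) (v x t) * dtPotential B (-i) (r x t) (v x t) (u x t) * hq
      - q x t * dtPotential B i (q x t) (u x t) (v x t) * hr
      - 2 * dX (fun x t => dtCoeff B (u x t) (v x t) 1) x t * hi

theorem potential_evolution (h : IsMatrixLaxPair B i q r u v) (hi : i ^ 2 = -1) (hN : 0 < N)
    (hB : B.det ≠ 0) (hqs : SmoothOnPlane Set.univ q) (hrs : SmoothOnPlane Set.univ r)
    (hq : ∀ x t, dT q x t = dX (fun x t => q x t ^ 2 * r x t - i * dX q x t) x t)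
    (hr : ∀ x t, dT r x t = dX (fun x t => r x t ^ 2 * q x t + i * dX r x t) x t)
    {x t : ℝ} (hp : (x, t) ∈ dtDomain B u v) :
    dT (fun x t => dtPotential B i (q x t) (u x t) (v x t)) x t
      = dX (fun x t => dtPotential B i (q x t) (u x t) (v x t) ^ 2
          * dtPotential B (-i) (r x t) (v x t) (u x t)
          - i * dX (fun x t => dtPotential B i (q x t) (u x t) (v x t)) x t) x t := by
  have hD := h.isOpen_dtDomain
  have hp' : (x, t) ∈ dtDomain B v u := by rwa [dtDomain_symm]
  obtain ⟨m, rfl⟩ : ∃ m, N = m + 1 := ⟨N - 1, by omega⟩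
  set κ : ℂ := (-1) ^ (m + 1) * B.det with hκ
  have hκ0 : κ ≠ 0 := mul_ne_zero (pow_ne_zero _ (by norm_num)) hB
  have hQ := h.smooth_dtPotential hqs i
  have hR : SmoothOnPlane (dtDomain B u v)
      fun x t => dtPotential B (-i) (r x t) (v x t) (u x t) := by
    have := h.symm.smooth_dtPotential hrs (-i)
    rwa [dtDomain_symm] at this
  set Q : ℝ → ℝ → ℂ := fun x t => dtPotential B i (q x t) (u x t) (v x t) with hQdef
  set R : ℝ → ℝ → ℂ := fun x t => dtPotential B (-i) (r x t) (v x t) (u x t) with hRdef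
  set c : ℝ → ℝ → ℂ := fun x t => dtCoeff B (u x t) (v x t) m with hcdef
  have hc : SmoothOnPlane (dtDomain B u v) c := h.smooth_dtCoeff m
  have hz2 : ∀ k, m + 1 < k → (fun x t => dtCoeff B (u x t) (v x t) k) = fun _ _ => (0 : ℂ) :=
    fun k hk => by
      ext x t
      exact dtCoeff_eq_zero _ _ _ hk
  -- At `k = m = N - 1` the coefficient of index `k + 2` is zero and both coefficients of index `k +
  -- 1` equal `κ`, so only the potentials survive.
  have ex : ∀ x t, (x, t) ∈ dtDomain B u v → dX c x t = κ * (Q x t - alt m (r x t) (q x t)) := by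
    intro x t hp
    have := h.x_relation hN hB hp m (Nat.le_succ m)
    rw [dtCoeff_eq_zero _ _ _ (show m + 1 < m + 2 by omega), dtCoeff_last hp.2,
      dtCoeff_last hp.1] at this
    linear_combination this
  have et : ∀ x t, (x, t) ∈ dtDomain B u v → dT c x t = κ * ((Q x t ^ 2 * R x t - i * dX Q x t)
      - alt m (r x t ^ 2 * q x t + i * dX r x t) (q x t ^ 2 * r x t - i * dX q x t)) := by
    intro x t hp
    have := h.t_relation hi hN hB hqs hp m (Nat.le_succ m)
    rw [hz2 (m + 2) (by omega), dtCoeff_eq_zero _ _ _ (show m + 1 < m + 2 by omega),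
      dtCoeff_last hp.2, dtCoeff_last hp.1, show dX (fun _ _ => (0 : ℂ)) x t = 0 by simp [dX]]
      at this
    linear_combination this
  -- Compatibility of this single coefficient suffices: `c_xt = c_tx` compares the new conservation
  -- law with that of the seed.
  have hcross := hc.dT_dX hD hp
  rw [dT_congr hD ex hp, dX_congr hD et hp] at hcross
  have hW : SmoothOnPlane (dtDomain B u v) fun x t => Q x t ^ 2 * R x t - i * dX Q x t :=
    ((hQ.pow 2).mul hR).sub (contDiffOn_const.mul (hQ.dX hD))
  have hWq : SmoothOnPlane Set.univ fun x t => q x t ^ 2 * r x t - i * dX q x t :=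
    ((hqs.pow 2).mul hrs).sub (contDiffOn_const.mul (hqs.dX isOpen_univ))
  have hWr : SmoothOnPlane Set.univ fun x t => r x t ^ 2 * q x t + i * dX r x t :=
    ((hrs.pow 2).mul hqs).add (contDiffOn_const.mul (hrs.dX isOpen_univ))
  have main : ∀ s w : ℝ → ℝ → ℂ, SmoothOnPlane Set.univ s → SmoothOnPlane Set.univ w →
      dT s x t = dX w x t →
      dT (fun x t => κ * (Q x t - s x t)) x t
        = dX (fun x t => κ * ((Q x t ^ 2 * R x t - i * dX Q x t) - w x t)) x t →
      dT Q x t = dX (fun x t => Q x t ^ 2 * R x t - i * dX Q x t) x t := by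
    intro s w hs hw hsw hcross
    have e1 : dT (fun x t => κ * (Q x t - s x t)) x t = κ * (dT Q x t - dT s x t) :=
      (((hQ.hasDerivAt_dT hD hp).sub
        (hs.hasDerivAt_dT isOpen_univ (Set.mem_univ (x, t)))).const_mul κ).deriv
    have e2 : dX (fun x t => κ * ((Q x t ^ 2 * R x t - i * dX Q x t) - w x t)) x t
        = κ * (dX (fun x t => Q x t ^ 2 * R x t - i * dX Q x t) x t - dX w x t) :=
      (((hW.hasDerivAt_dX hD hp).sub
        (hw.hasDerivAt_dX isOpen_univ (Set.mem_univ (x, t)))).const_mul κ).deriv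
    rw [e1, e2, hsw] at hcross
    exact sub_left_injective (mul_left_cancel₀ hκ0 hcross)
  -- The seed potential in the subleading coefficient is `r` for odd `N` and `q` for even `N`;
  -- either one satisfies its own conservation law.
  by_cases hm : Even m
  · simp only [alt, hm, if_true] at hcross
    exact main r _ hrs hWr (hr x t) hcross
  · simp only [alt, hm, if_false] at hcross
    exact main q _ hqs hWq (hq x t) hcross

end IsMatrixLaxPair

end

noncomputable section

/-! ### Families of holomorphic functions depending smoothly on `(x, t)` -/

/-- `F (x, t, z)` is smooth for `z ∈ S`, and holomorphic in `z`. -/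
structure IsHoloFamily (S : Set ℂ) (F : ℝ → ℝ → ℂ → ℂ) : Prop where
  smooth : ContDiffOn ℝ ∞ (fun p : ℝ × ℝ × ℂ => F p.1 p.2.1 p.2.2) {p | p.2.2 ∈ S}
  holo : ∀ x t, DifferentiableOn ℂ (F x t) S

/-- On `S`, the derivative of `F (x, t, z)` in the direction `e` is `G (x, t, z)`. -/
def HasFamilyDeriv (S : Set ℂ) (e : ℝ × ℝ × ℂ) (F G : ℝ → ℝ → ℂ → ℂ) : Prop :=
  ∀ p : ℝ × ℝ × ℂ, p.2.2 ∈ S →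
    fderiv ℝ (fun p : ℝ × ℝ × ℂ => F p.1 p.2.1 p.2.2) p e = G p.1 p.2.1 p.2.2

theorem isOpen_familyDomain {S : Set ℂ} (hS : IsOpen S) :
    IsOpen {p : ℝ × ℝ × ℂ | p.2.2 ∈ S} :=
  hS.preimage (continuous_snd.comp continuous_snd)

namespace IsHoloFamily

variable {S : Set ℂ} {F G : ℝ → ℝ → ℂ → ℂ}

theorem differentiableAt (hF : IsHoloFamily S F) (hS : IsOpen S) {p : ℝ × ℝ × ℂ}
    (hp : p.2.2 ∈ S) : DifferentiableAt ℝ (fun p : ℝ × ℝ × ℂ => F p.1 p.2.1 p.2.2) p :=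
  (hF.smooth.contDiffAt ((isOpen_familyDomain hS).mem_nhds hp)).differentiableAt (by simp)

/-- Reads the complex derivative as a real directional derivative, which makes the symmetry of real
second derivatives available for mixing `λ` with `x` and `t`. -/
theorem hasFamilyDeriv_deriv (hF : IsHoloFamily S F) (hS : IsOpen S) :
    HasFamilyDeriv S (0, 0, 1) F fun x t => deriv (F x t) := by
  rintro ⟨x, t, z⟩ hz
  have h1 : HasFDerivAt (fun y : ℂ => ((x, t, y) : ℝ × ℝ × ℂ))
      ((ContinuousLinearMap.inr ℝ ℝ (ℝ × ℂ)).comp (ContinuousLinearMap.inr ℝ ℝ ℂ)) z := by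
    have := (hasFDerivAt_const (𝕜 := ℝ) x z).prodMk
      ((hasFDerivAt_const (𝕜 := ℝ) t z).prodMk (hasFDerivAt_id (𝕜 := ℝ) z))
    exact this
  have h2 := (hF.differentiableAt hS (p := (x, t, z)) hz).hasFDerivAt.comp z h1
  have h3 := ((hF.holo x t).differentiableAt (hS.mem_nhds hz)).hasDerivAt.hasFDerivAt.restrictScalars
    ℝ
  have := congrArg (fun L : ℂ →L[ℝ] ℂ => L 1) (h2.unique h3)
  simpa using this

theorem smooth_fderiv_apply (hF : IsHoloFamily S F) (hS : IsOpen S) (e : ℝ × ℝ × ℂ) :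
    ContDiffOn ℝ ∞ (fun p => fderiv ℝ (fun p : ℝ × ℝ × ℂ => F p.1 p.2.1 p.2.2) p e)
      {p | p.2.2 ∈ S} :=
  (hF.smooth.fderiv_of_isOpen (isOpen_familyDomain hS) (by simp)).clm_apply contDiffOn_const

theorem deriv (hF : IsHoloFamily S F) (hS : IsOpen S) :
    IsHoloFamily S fun x t => deriv (F x t) where
  smooth := (hF.smooth_fderiv_apply hS (0, 0, 1)).congr fun p hp =>
    (hF.hasFamilyDeriv_deriv hS p hp).symm
  holo x t := (hF.holo x t).deriv hS

theorem iteratedDeriv (hF : IsHoloFamily S F) (hS : IsOpen S) (m : ℕ) :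
    IsHoloFamily S fun x t => iteratedDeriv m (F x t) := by
  induction m with
  | zero => simpa only [iteratedDeriv_zero] using hF
  | succ m ih => simpa only [iteratedDeriv_succ] using ih.deriv hS

theorem fderiv_fderiv_apply (hF : IsHoloFamily S F) (hS : IsOpen S) {p : ℝ × ℝ × ℂ}
    (hp : p.2.2 ∈ S) (a b : ℝ × ℝ × ℂ) :
    fderiv ℝ (fun p => fderiv ℝ (fun p : ℝ × ℝ × ℂ => F p.1 p.2.1 p.2.2) p a) p b
      = fderiv ℝ (fderiv ℝ fun p : ℝ × ℝ × ℂ => F p.1 p.2.1 p.2.2) p b a := by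
  have hc := hF.smooth.contDiffAt ((isOpen_familyDomain hS).mem_nhds hp)
  have hd : DifferentiableAt ℝ (fderiv ℝ fun p : ℝ × ℝ × ℂ => F p.1 p.2.1 p.2.2) p :=
    (hc.fderiv_right (m := 1) (WithTop.coe_le_coe.2 le_top)).differentiableAt one_ne_zero
  rw [fderiv_clm_apply hd (differentiableAt_const a)]
  simp

theorem hasFamilyDeriv_comm (hF : IsHoloFamily S F) (hG : IsHoloFamily S G) (hS : IsOpen S)
    {e : ℝ × ℝ × ℂ} (h : HasFamilyDeriv S e F G) :
    HasFamilyDeriv S e (fun x t => _root_.deriv (F x t)) fun x t => _root_.deriv (G x t) := by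
  intro p hp
  have hn := (isOpen_familyDomain hS).mem_nhds hp
  have hc := hF.smooth.contDiffAt hn
  have hsymm := hc.isSymmSndFDerivAt
    (by rw [minSmoothness_of_isRCLikeNormedField]; exact WithTop.coe_le_coe.2 le_top)
  have e1 : (fun p : ℝ × ℝ × ℂ => _root_.deriv (F p.1 p.2.1) p.2.2) =ᶠ[𝓝 p]
      fun p => fderiv ℝ (fun p : ℝ × ℝ × ℂ => F p.1 p.2.1 p.2.2) p (0, 0, 1) :=
    Filter.eventuallyEq_of_mem hn fun p hp => (hF.hasFamilyDeriv_deriv hS p hp).symm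
  have e2 : (fun p : ℝ × ℝ × ℂ => G p.1 p.2.1 p.2.2) =ᶠ[𝓝 p]
      fun p => fderiv ℝ (fun p : ℝ × ℝ × ℂ => F p.1 p.2.1 p.2.2) p e :=
    Filter.eventuallyEq_of_mem hn fun p hp => (h p hp).symm
  rw [← hG.hasFamilyDeriv_deriv hS p hp, e1.fderiv_eq, e2.fderiv_eq,
    hF.fderiv_fderiv_apply hS hp, hF.fderiv_fderiv_apply hS hp, hsymm.eq]

theorem hasFamilyDeriv_iteratedDeriv (hF : IsHoloFamily S F) (hG : IsHoloFamily S G)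
    (hS : IsOpen S) {e : ℝ × ℝ × ℂ} (h : HasFamilyDeriv S e F G) (m : ℕ) :
    HasFamilyDeriv S e (fun x t => _root_.iteratedDeriv m (F x t))
      fun x t => _root_.iteratedDeriv m (G x t) := by
  induction m with
  | zero => simpa only [iteratedDeriv_zero] using h
  | succ m ih =>
    simpa only [iteratedDeriv_succ] using
      (hF.iteratedDeriv hS m).hasFamilyDeriv_comm (hG.iteratedDeriv hS m) hS ih

theorem hasDerivAt_fst (hF : IsHoloFamily S F) (hS : IsOpen S)
    (h : HasFamilyDeriv S (1, 0, 0) F G) {z : ℂ} (hz : z ∈ S) (x t : ℝ) :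
    HasDerivAt (fun y => F y t z) (G x t z) x := by
  have := (hF.differentiableAt hS (p := (x, t, z)) hz).hasFDerivAt.comp_hasDerivAt x
    ((hasDerivAt_id x).prodMk (hasDerivAt_const x (t, z)))
  rw [← h (x, t, z) hz]
  exact this

theorem hasDerivAt_snd (hF : IsHoloFamily S F) (hS : IsOpen S)
    (h : HasFamilyDeriv S (0, 1, 0) F G) {z : ℂ} (hz : z ∈ S) (x t : ℝ) :
    HasDerivAt (fun s => F x s z) (G x t z) t := by
  have := (hF.differentiableAt hS (p := (x, t, z)) hz).hasFDerivAt.comp_hasDerivAt t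
    ((hasDerivAt_const t x).prodMk ((hasDerivAt_id t).prodMk (hasDerivAt_const t z)))
  rw [← h (x, t, z) hz]
  exact this

theorem hasFamilyDeriv_fst (hF : IsHoloFamily S F) (hS : IsOpen S)
    (h : ∀ x t, ∀ z ∈ S, dX (fun y s => F y s z) x t = G x t z) :
    HasFamilyDeriv S (1, 0, 0) F G := by
  rintro ⟨x, t, z⟩ hz
  have := (hF.differentiableAt hS (p := (x, t, z)) hz).hasFDerivAt.comp_hasDerivAt x
    ((hasDerivAt_id x).prodMk (hasDerivAt_const x (t, z)))
  exact this.deriv.symm.trans (h x t z hz)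

theorem hasFamilyDeriv_snd (hF : IsHoloFamily S F) (hS : IsOpen S)
    (h : ∀ x t, ∀ z ∈ S, dT (fun y s => F y s z) x t = G x t z) :
    HasFamilyDeriv S (0, 1, 0) F G := by
  rintro ⟨x, t, z⟩ hz
  have := (hF.differentiableAt hS (p := (x, t, z)) hz).hasFDerivAt.comp_hasDerivAt t
    ((hasDerivAt_const t x).prodMk ((hasDerivAt_id t).prodMk (hasDerivAt_const t z)))
  exact this.deriv.symm.trans (h x t z hz)

theorem add (hF : IsHoloFamily S F) (hG : IsHoloFamily S G) :
    IsHoloFamily S fun x t z => F x t z + G x t z where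
  smooth := hF.smooth.add hG.smooth
  holo x t := (hF.holo x t).add (hG.holo x t)

theorem mul_pow (hF : IsHoloFamily S F) (k : ℕ) :
    IsHoloFamily S fun x t z => z ^ k * F x t z where
  smooth := ((contDiff_snd.comp contDiff_snd).pow k).contDiffOn.mul hF.smooth
  holo x t := ((differentiable_id.pow k).differentiableOn).mul (hF.holo x t)

theorem smul (hF : IsHoloFamily S F) {a : ℝ → ℝ → ℂ} (ha : SmoothOnPlane Set.univ a) :
    IsHoloFamily S fun x t z => a x t * F x t z where
  smooth := by
    have : ContDiff ℝ ∞ fun p : ℝ × ℝ × ℂ => a p.1 p.2.1 :=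
      (contDiffOn_univ.1 ha).comp (contDiff_fst.prodMk (contDiff_fst.comp contDiff_snd))
    exact this.contDiffOn.mul hF.smooth
  holo x t := (differentiableOn_const _).mul (hF.holo x t)

end IsHoloFamily

/-! ### Jets at the coalesced parameters -/

variable {N : ℕ}

/-- The order of the Taylor coefficient in the row `j`. -/
def jetOrder (N n : ℕ) (j : Fin N) : ℕ := if (j : ℕ) + 1 ≤ N - 2 * n then (j : ℕ) / 2 else 0

/-- The Taylor coefficients of `f` at the coalesced parameters. -/
def jet (N n : ℕ) (lam : ℕ → ℂ) (f : ℂ → ℂ) (j : Fin N) : ℂ :=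
  iteratedDeriv (jetOrder N n j) f (coalesced N n lam j) / ((jetOrder N n j).factorial : ℂ)

theorem degMatrix_eq (n : ℕ) (e : ℕ → ℂ → ℂ) (lam : ℕ → ℂ) :
    degMatrix N n e lam = Matrix.of fun j k : Fin N => jet N n lam (e (k + 1)) j := by
  ext j k
  simp only [degMatrix, jet, jetOrder, Matrix.of_apply, taylorIndex]
  by_cases h : (j : ℕ) + 1 ≤ N - 2 * n
  -- For the zero-based row index `j` the order `n_j - 1` is `j / 2`.
  · simp only [h, if_true, show ((j : ℕ) + 1 + 1) / 2 - 1 = (j : ℕ) / 2 by omega]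
  · simp [h, coalesced]

/-- The matrix of the multiplication by the spectral parameter on jets. -/
def jetShift (N n : ℕ) (lam : ℕ → ℂ) : Matrix (Fin N) (Fin N) ℂ :=
  Matrix.of fun j l => (if l = j then coalesced N n lam j else 0)
    + if (l : ℕ) + 2 = j ∧ (j : ℕ) + 1 ≤ N - 2 * n then 1 else 0

/-- Lower triangularity; through this determinant nonzero parameters make `B` invertible. -/
theorem det_jetShift (n : ℕ) (lam : ℕ → ℂ) :
    (jetShift N n lam).det = ∏ j, coalesced N n lam j := by
  rw [Matrix.det_of_isLowerTriangular]
  · exact Finset.prod_congr rfl fun j _ => by simp [jetShift]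
  · intro j l h
    have h' : (j : ℕ) < l := h
    simp only [jetShift, Matrix.of_apply]
    rw [if_neg (fun h => by subst h; exact lt_irrefl _ h'), if_neg (fun h => by omega), add_zero]

theorem coalesced_add_two {n : ℕ} (lam : ℕ → ℂ) {j l : Fin N} (h : (l : ℕ) + 2 = j)
    (hj : (j : ℕ) + 1 ≤ N - 2 * n) : coalesced N n lam l = coalesced N n lam j := by
  have hl : (l : ℕ) + 1 ≤ N - 2 * n := by omega
  have : Odd ((j : ℕ) + 1) ↔ Odd ((l : ℕ) + 1) := by
    rw [← h, show (l : ℕ) + 2 + 1 = (l + 1) + 2 by ring]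
    simp [Nat.odd_add]
  simp [coalesced, hj, hl, this]

section Jet

variable {S : Set ℂ} {n : ℕ} {lam : ℕ → ℂ} {f g : ℂ → ℂ}

theorem jet_add (hS : IsOpen S) (hlam : ∀ j, coalesced N n lam j ∈ S)
    (hf : DifferentiableOn ℂ f S) (hg : DifferentiableOn ℂ g S) :
    jet N n lam (fun z => f z + g z) = jet N n lam f + jet N n lam g := by
  ext j
  simp only [jet, Pi.add_apply]
  rw [iteratedDeriv_fun_add ((hf.contDiffOn hS).contDiffAt (hS.mem_nhds (hlam j)))
    ((hg.contDiffOn hS).contDiffAt (hS.mem_nhds (hlam j))), add_div]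

theorem jet_const_mul (a : ℂ) (f : ℂ → ℂ) :
    jet N n lam (fun z => a * f z) = a • jet N n lam f := by
  ext j
  simp only [jet, Pi.smul_apply, smul_eq_mul]
  rw [iteratedDeriv_const_mul_field, mul_div_assoc]

theorem iteratedDeriv_id_mul {m : ℕ} {a : ℂ} (hf : ContDiffAt ℂ (m + 1) f a) :
    iteratedDeriv (m + 1) (fun z => z * f z) a
      = a * iteratedDeriv (m + 1) f a + (m + 1) * iteratedDeriv m f a := by
  rw [iteratedDeriv_fun_mul (n := m + 1) contDiffAt_id (by exact_mod_cast hf),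
    Finset.sum_range_succ', Finset.sum_range_succ', Finset.sum_eq_zero]
  · simp [iteratedDeriv_fun_id]
    ring
  · intro k _
    simp [iteratedDeriv_fun_id]

/-- Leibniz's rule: `(zf)^(m)/m! = a f^(m)/m! + f^(m-1)/(m-1)!` at `a`. The coefficient of order one
less at the same parameter sits two rows higher, because the rows alternate between `λ_1` and `λ_2`.
-/
theorem jet_id_mul (hS : IsOpen S) (hlam : ∀ j, coalesced N n lam j ∈ S)
    (hf : DifferentiableOn ℂ f S) :
    jet N n lam (fun z => z * f z) = (jetShift N n lam).mulVec (jet N n lam f) := by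
  ext j
  simp only [Matrix.mulVec, dotProduct, jetShift, Matrix.of_apply, add_mul, ite_mul, zero_mul,
    Finset.sum_add_distrib, Finset.sum_ite_eq', Finset.mem_univ, if_true, one_mul]
  by_cases h : 2 ≤ (j : ℕ) ∧ (j : ℕ) + 1 ≤ N - 2 * n
  · obtain ⟨h2, h3⟩ := h
    let l : Fin N := ⟨j - 2, by omega⟩
    have hl : (l : ℕ) + 2 = j := by simp [l]; omega
    rw [Finset.sum_eq_single l (fun b _ hb => if_neg fun h => hb (Fin.ext (by omega)))
      (fun h => absurd (Finset.mem_univ l) h), if_pos ⟨hl, h3⟩]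
    have hm : jetOrder N n j = jetOrder N n l + 1 := by
      simp only [jetOrder, h3, if_true, show (l : ℕ) + 1 ≤ N - 2 * n by omega]
      omega
    have hfac : (((jetOrder N n l).factorial : ℕ) : ℂ) ≠ 0 :=
      Nat.cast_ne_zero.2 (Nat.factorial_ne_zero _)
    have hm1 : ((jetOrder N n l : ℂ) + 1) ≠ 0 := Nat.cast_add_one_ne_zero _
    simp only [jet]
    rw [coalesced_add_two lam hl h3, hm,
      iteratedDeriv_id_mul ((hf.contDiffOn hS).contDiffAt (hS.mem_nhds (hlam j))),
      Nat.factorial_succ]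
    push_cast
    field_simp
  -- In the first two rows and in the last `2n` rows the order is zero, so there is no lower
  -- coefficient to pick up.
  · rw [Finset.sum_eq_zero fun b _ => if_neg fun h' => h (by omega)]
    have hm : jetOrder N n j = 0 := by
      simp only [jetOrder]
      split_ifs with h'
      · omega
      · rfl
    simp [jet, hm]

theorem jet_pow_mul (hS : IsOpen S) (hlam : ∀ j, coalesced N n lam j ∈ S)
    (hf : DifferentiableOn ℂ f S) (k : ℕ) :
    jet N n lam (fun z => z ^ k * f z) = (jetShift N n lam ^ k).mulVec (jet N n lam f) := by
  induction k with
  | zero => simp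
  | succ k ih =>
    have hk : DifferentiableOn ℂ (fun z => z ^ k * f z) S :=
      (differentiable_id.pow k).differentiableOn.mul hf
    rw [pow_succ', ← Matrix.mulVec_mulVec, ← ih, ← jet_id_mul hS hlam hk]
    simp only [pow_succ', mul_assoc]

theorem jet_entry (hS : IsOpen S) (hlam : ∀ j, coalesced N n lam j ∈ S)
    (hf : DifferentiableOn ℂ f S) (hg : DifferentiableOn ℂ g S) (k : ℕ) :
    jet N n lam (fun z => z ^ (N - k) * alt k f g z)
      = jetCol (jetShift N n lam) (jet N n lam f) (jet N n lam g) k := by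
  unfold jetCol
  by_cases h : Even k <;> simp only [alt, h, if_true, if_false]
  · exact jet_pow_mul hS hlam hf _
  · exact jet_pow_mul hS hlam hg _

/-- `P` is `M` with the components exchanged, so statements about `M` also cover `P`; the same holds
for `W` and `H`. -/
theorem entryP_eq (f g : ℂ → ℂ) : entryP N f g = entryM N g f := rfl

theorem det_degMatrix_entryM (hS : IsOpen S) (hlam : ∀ j, coalesced N n lam j ∈ S)
    (hf : DifferentiableOn ℂ f S) (hg : DifferentiableOn ℂ g S) :
    (degMatrix N n (entryM N f g) lam).det
      = colMinor (jetShift N n lam) (jet N n lam f) (jet N n lam g) 0 := by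
  rw [degMatrix_eq, colMinor]
  congr 1
  ext j k
  simp only [Matrix.of_apply, not_lt_zero, if_false]
  rw [← jet_entry hS hlam hf hg]
  congr 1
  ext z
  by_cases h : Odd ((k : ℕ) + 1)
  · simp [entryM, alt, h, Nat.not_even_iff_odd.2 h]
  · simp [entryM, alt, h, Nat.not_odd_iff_even.1 h]

theorem det_degMatrix_entryH (hS : IsOpen S) (hlam : ∀ j, coalesced N n lam j ∈ S)
    (hf : DifferentiableOn ℂ f S) (hg : DifferentiableOn ℂ g S) :
    (degMatrix N n (entryH N f g) lam).det
      = colMinor (jetShift N n lam) (jet N n lam f) (jet N n lam g) 1 := by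
  rw [degMatrix_eq, colMinor]
  congr 1
  ext j k
  simp only [Matrix.of_apply, Nat.lt_one_iff]
  rw [← jet_entry hS hlam hf hg]
  congr 1
  ext z
  by_cases h0 : (k : ℕ) = 0
  · simp [entryH, h0, alt]
  by_cases h : Odd ((k : ℕ) + 1)
  · simp [entryH, alt, h0, h, Nat.not_even_iff_odd.2 h]
  · simp [entryH, alt, h0, h, Nat.not_odd_iff_even.1 h]

end Jet

/-! ### The jets of an eigenfamily solve a matrix Lax pair -/

section Lax

variable {S : Set ℂ} {n : ℕ} {lam : ℕ → ℂ} {F G : ℝ → ℝ → ℂ → ℂ}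

theorem contDiff_jet (hF : IsHoloFamily S F) (hS : IsOpen S)
    (hlam : ∀ j, coalesced N n lam j ∈ S) :
    ContDiff ℝ ∞ fun p : ℝ × ℝ => jet N n lam (F p.1 p.2) := by
  rw [contDiff_pi]
  intro j
  have h := (hF.iteratedDeriv hS (jetOrder N n j)).smooth
  have h2 : ContDiff ℝ ∞ fun p : ℝ × ℝ => ((p.1, p.2, coalesced N n lam j) : ℝ × ℝ × ℂ) :=
    contDiff_fst.prodMk (contDiff_snd.prodMk contDiff_const)
  have h3 : ContDiff ℝ ∞ fun p : ℝ × ℝ =>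
      iteratedDeriv (jetOrder N n j) (F p.1 p.2) (coalesced N n lam j) :=
    contDiffOn_univ.1 (h.comp h2.contDiffOn fun p _ => hlam j)
  simp only [jet, div_eq_mul_inv]
  exact h3.mul contDiff_const

theorem hasDerivAt_jet_fst (hF : IsHoloFamily S F) (hG : IsHoloFamily S G) (hS : IsOpen S)
    (hlam : ∀ j, coalesced N n lam j ∈ S)
    (h : ∀ x t, ∀ z ∈ S, dX (fun y s => F y s z) x t = G x t z) (x t : ℝ) :
    HasDerivAt (fun y => jet N n lam (F y t)) (jet N n lam (G x t)) x := by
  rw [hasDerivAt_pi]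
  exact fun j => ((hF.iteratedDeriv hS _).hasDerivAt_fst hS
    (hF.hasFamilyDeriv_iteratedDeriv hG hS (hF.hasFamilyDeriv_fst hS h) (jetOrder N n j))
    (hlam j) x t).div_const _

theorem hasDerivAt_jet_snd (hF : IsHoloFamily S F) (hG : IsHoloFamily S G) (hS : IsOpen S)
    (hlam : ∀ j, coalesced N n lam j ∈ S)
    (h : ∀ x t, ∀ z ∈ S, dT (fun y s => F y s z) x t = G x t z) (x t : ℝ) :
    HasDerivAt (fun s => jet N n lam (F x s)) (jet N n lam (G x t)) t := by
  rw [hasDerivAt_pi]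
  exact fun j => ((hF.iteratedDeriv hS _).hasDerivAt_snd hS
    (hF.hasFamilyDeriv_iteratedDeriv hG hS (hF.hasFamilyDeriv_snd hS h) (jetOrder N n j))
    (hlam j) x t).div_const _

theorem laxU_fst (q r : ℝ → ℝ → ℂ) (x t : ℝ) (z a b : ℂ) :
    (laxU q r x t z).mulVec ![a, b] 0 = Complex.I * (z ^ 2 * a) + q x t * (z ^ 1 * b) := by
  simp [laxU, laxSigma, laxQ, Matrix.mulVec, dotProduct, Fin.sum_univ_two]
  ring

theorem laxU_snd (q r : ℝ → ℝ → ℂ) (x t : ℝ) (z a b : ℂ) :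
    (laxU q r x t z).mulVec ![a, b] 1 = -Complex.I * (z ^ 2 * b) + r x t * (z ^ 1 * a) := by
  simp [laxU, laxSigma, laxQ, Matrix.mulVec, dotProduct, Fin.sum_univ_two]
  ring

theorem laxV_fst (q r : ℝ → ℝ → ℂ) (x t : ℝ) (z a b : ℂ) :
    (laxV q r x t z).mulVec ![a, b] 0 = 2 * Complex.I * (z ^ 4 * a) + 2 * q x t * (z ^ 3 * b)
      + Complex.I * (q x t * r x t) * (z ^ 2 * a)
      + (q x t ^ 2 * r x t - Complex.I * dX q x t) * (z ^ 1 * b) := by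
  simp [laxV, laxSigma, laxQ, Matrix.mulVec, dotProduct, Fin.sum_univ_two, pow_succ]
  ring

theorem laxV_snd (q r : ℝ → ℝ → ℂ) (x t : ℝ) (z a b : ℂ) :
    (laxV q r x t z).mulVec ![a, b] 1 = 2 * -Complex.I * (z ^ 4 * b) + 2 * r x t * (z ^ 3 * a)
      + -Complex.I * (q x t * r x t) * (z ^ 2 * b)
      + (r x t ^ 2 * q x t + Complex.I * dX r x t) * (z ^ 1 * a) := by
  simp [laxV, laxSigma, laxQ, Matrix.mulVec, dotProduct, Fin.sum_univ_two, pow_succ]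
  ring

theorem jet_x_combination {a b : ℝ → ℝ → ℂ} (hS : IsOpen S)
    (hlam : ∀ j, coalesced N n lam j ∈ S)
    (hF : IsHoloFamily S F) (hG : IsHoloFamily S G)
    (ha : SmoothOnPlane Set.univ a) (hb : SmoothOnPlane Set.univ b)
    (h : ∀ x t, ∀ z ∈ S, dX (fun y s => F y s z) x t
      = a x t * (z ^ 2 * F x t z) + b x t * (z ^ 1 * G x t z)) (x t : ℝ) :
    HasDerivAt (fun y => jet N n lam (F y t))
      (a x t • (jetShift N n lam ^ 2).mulVec (jet N n lam (F x t))
        + b x t • (jetShift N n lam ^ 1).mulVec (jet N n lam (G x t))) x := by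
  have e1 := (hF.mul_pow 2).smul ha
  have e2 := (hG.mul_pow 1).smul hb
  have := hasDerivAt_jet_fst hF (e1.add e2) hS hlam h x t
  rwa [jet_add hS hlam (e1.holo x t) (e2.holo x t), jet_const_mul, jet_const_mul,
    jet_pow_mul hS hlam (hF.holo x t), jet_pow_mul hS hlam (hG.holo x t)] at this

theorem jet_t_combination {a b c d : ℝ → ℝ → ℂ} (hS : IsOpen S)
    (hlam : ∀ j, coalesced N n lam j ∈ S)
    (hF : IsHoloFamily S F) (hG : IsHoloFamily S G)
    (ha : SmoothOnPlane Set.univ a) (hb : SmoothOnPlane Set.univ b)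
    (hc : SmoothOnPlane Set.univ c) (hd : SmoothOnPlane Set.univ d)
    (h : ∀ x t, ∀ z ∈ S, dT (fun y s => F y s z) x t
      = a x t * (z ^ 4 * F x t z) + b x t * (z ^ 3 * G x t z) + c x t * (z ^ 2 * F x t z)
        + d x t * (z ^ 1 * G x t z)) (x t : ℝ) :
    HasDerivAt (fun s => jet N n lam (F x s))
      (a x t • (jetShift N n lam ^ 4).mulVec (jet N n lam (F x t))
        + b x t • (jetShift N n lam ^ 3).mulVec (jet N n lam (G x t))
        + c x t • (jetShift N n lam ^ 2).mulVec (jet N n lam (F x t))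
        + d x t • (jetShift N n lam ^ 1).mulVec (jet N n lam (G x t))) t := by
  have e1 := (hF.mul_pow 4).smul ha
  have e2 := (hG.mul_pow 3).smul hb
  have e3 := (hF.mul_pow 2).smul hc
  have e4 := (hG.mul_pow 1).smul hd
  have := hasDerivAt_jet_snd hF (((e1.add e2).add e3).add e4) hS hlam h x t
  rwa [jet_add hS hlam (((e1.add e2).add e3).holo x t) (e4.holo x t),
    jet_add hS hlam ((e1.add e2).holo x t) (e3.holo x t),
    jet_add hS hlam (e1.holo x t) (e2.holo x t), jet_const_mul, jet_const_mul, jet_const_mul,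
    jet_const_mul, jet_pow_mul hS hlam (hF.holo x t), jet_pow_mul hS hlam (hG.holo x t),
    jet_pow_mul hS hlam (hF.holo x t), jet_pow_mul hS hlam (hG.holo x t)] at this

/-- Taking jets is linear, commutes with the derivatives in `x` and `t`, and turns powers of `λ`
into powers of `B`. -/
theorem IsEigenfamily.isMatrixLaxPair {q r : ℝ → ℝ → ℂ} {φ ψ : ℝ → ℝ → ℂ → ℂ}
    (hΨ : IsEigenfamily q r S φ ψ) (hq : SmoothOnPlane Set.univ q)
    (hr : SmoothOnPlane Set.univ r) (hlam : ∀ j, coalesced N n lam j ∈ S) :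
    IsMatrixLaxPair (jetShift N n lam) Complex.I q r (fun x t => jet N n lam (φ x t))
      fun x t => jet N n lam (ψ x t) := by
  have hS := hΨ.isOpen
  have hφ : IsHoloFamily S φ := ⟨hΨ.smooth_fst, hΨ.holo_fst⟩
  have hψ : IsHoloFamily S ψ := ⟨hΨ.smooth_snd, hΨ.holo_snd⟩
  have hconst : ∀ c : ℂ, SmoothOnPlane Set.univ fun _ _ => c := fun c => contDiffOn_const
  have hqr : SmoothOnPlane Set.univ fun x t => q x t * r x t := hq.mul hr
  have hqx := hq.dX isOpen_univ
  have hrx := hr.dX isOpen_univ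
  refine ⟨contDiff_jet hφ hS hlam, contDiff_jet hψ hS hlam, ?_, ?_, ?_, ?_⟩
  · refine jet_x_combination hS hlam hφ hψ (hconst Complex.I) hq fun x t z hz => ?_
    rw [← laxU_fst q r, ← hΨ.lax_x x t z hz]
    rfl
  · refine jet_x_combination hS hlam hψ hφ (hconst (-Complex.I)) hr fun x t z hz => ?_
    rw [← laxU_snd q r, ← hΨ.lax_x x t z hz]
    rfl
  · refine jet_t_combination hS hlam hφ hψ (hconst (2 * Complex.I)) ((hconst 2).mul hq)
      ((hconst Complex.I).mul hqr) (((hq.pow 2).mul hr).sub ((hconst Complex.I).mul hqx))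
      fun x t z hz => ?_
    refine Eq.trans ?_ (laxV_fst q r x t z _ _)
    rw [← hΨ.lax_t x t z hz]
    rfl
  · refine jet_t_combination hS hlam hψ hφ (hconst (2 * -Complex.I)) ((hconst 2).mul hr)
      ((hconst (-Complex.I)).mul hqr) (((hr.pow 2).mul hq).add ((hconst Complex.I).mul hrx))
      fun x t z hz => ?_
    refine Eq.trans ?_ (laxV_snd q r x t z _ _)
    rw [← hΨ.lax_t x t z hz]
    rfl

/-- The conservation-law form, obtained on multiplying the equation by `-i`; it is the form used in
the cross-differentiation. -/
theorem IsKNSolutionOn.evolution_fst {q r : ℝ → ℝ → ℂ} (h : IsKNSolutionOn Set.univ q r)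
    (x t : ℝ) : dT q x t = dX (fun x t => q x t ^ 2 * r x t - Complex.I * dX q x t) x t := by
  have h1 : SmoothOnPlane Set.univ fun x t => q x t ^ 2 * r x t := (h.smooth_q.pow 2).mul h.smooth_r
  have h2 := h.smooth_q.dX isOpen_univ
  have hp := Set.mem_univ (x, t)
  have e : dX (fun x t => q x t ^ 2 * r x t - Complex.I * dX q x t) x t
      = dX (fun x t => q x t ^ 2 * r x t) x t - Complex.I * dX (dX q) x t :=
    ((h1.hasDerivAt_dX isOpen_univ hp).sub
      ((h2.hasDerivAt_dX isOpen_univ hp).const_mul Complex.I)).deriv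
  rw [e]
  linear_combination (-Complex.I) * h.eq_q x t hp
    + (dT q x t - dX (fun x t => q x t ^ 2 * r x t) x t) * Complex.I_sq

end Lax

end

noncomputable section

/-! ### The degenerate Darboux transformation of the Kaup–Newell system -/

theorem IsKNSolutionOn.evolution_snd {q r : ℝ → ℝ → ℂ} (h : IsKNSolutionOn Set.univ q r)
    (x t : ℝ) : dT r x t = dX (fun x t => r x t ^ 2 * q x t + Complex.I * dX r x t) x t := by
  have h1 : SmoothOnPlane Set.univ fun x t => q x t * r x t ^ 2 := h.smooth_q.mul (h.smooth_r.pow 2)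
  have h2 := h.smooth_r.dX isOpen_univ
  have hp := Set.mem_univ (x, t)
  have e : dX (fun x t => q x t * r x t ^ 2 + Complex.I * dX r x t) x t
      = dX (fun x t => q x t * r x t ^ 2) x t + Complex.I * dX (dX r) x t :=
    ((h1.hasDerivAt_dX isOpen_univ hp).add
      ((h2.hasDerivAt_dX isOpen_univ hp).const_mul Complex.I)).deriv
  simp only [mul_comm (r _ _ ^ 2) (q _ _)]
  rw [e]
  linear_combination (-Complex.I) * h.eq_r x t hp
    + (dT r x t - dX (fun x t => q x t * r x t ^ 2) x t) * Complex.I_sq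

theorem isKNSolutionOn_of_evolution {D : Set (ℝ × ℝ)} (hD : IsOpen D) {q r : ℝ → ℝ → ℂ}
    (hq : SmoothOnPlane D q) (hr : SmoothOnPlane D r)
    (eq : ∀ x t, (x, t) ∈ D →
      dT q x t = dX (fun x t => q x t ^ 2 * r x t - Complex.I * dX q x t) x t)
    (er : ∀ x t, (x, t) ∈ D →
      dT r x t = dX (fun x t => r x t ^ 2 * q x t - -Complex.I * dX r x t) x t) :
    IsKNSolutionOn D q r where
  isOpen := hD
  smooth_q := hq
  smooth_r := hr
  eq_q x t hp := by
    have h1 : SmoothOnPlane D fun x t => q x t ^ 2 * r x t := (hq.pow 2).mul hr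
    have e : dX (fun x t => q x t ^ 2 * r x t - Complex.I * dX q x t) x t
        = dX (fun x t => q x t ^ 2 * r x t) x t - Complex.I * dX (dX q) x t :=
      ((h1.hasDerivAt_dX hD hp).sub
        (((hq.dX hD).hasDerivAt_dX hD hp).const_mul Complex.I)).deriv
    rw [eq x t hp, e]
    linear_combination (-dX (dX q) x t) * Complex.I_sq
  eq_r x t hp := by
    have h1 : SmoothOnPlane D fun x t => q x t * r x t ^ 2 := hq.mul (hr.pow 2)
    have e : dX (fun x t => q x t * r x t ^ 2 - -Complex.I * dX r x t) x t
        = dX (fun x t => q x t * r x t ^ 2) x t - -Complex.I * dX (dX r) x t :=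
      ((h1.hasDerivAt_dX hD hp).sub
        (((hr.dX hD).hasDerivAt_dX hD hp).const_mul (-Complex.I))).deriv
    have er' := er x t hp
    simp only [mul_comm (r _ _ ^ 2) (q _ _)] at er'
    rw [er', e]
    linear_combination (dX (dX r) x t) * Complex.I_sq

theorem IsMatrixLaxPair.isKNSolutionOn {N : ℕ} {B : Matrix (Fin N) (Fin N) ℂ}
    {q r : ℝ → ℝ → ℂ} {u v : ℝ → ℝ → Fin N → ℂ} (h : IsMatrixLaxPair B Complex.I q r u v)
    (hN : 0 < N) (hB : B.det ≠ 0) (hqr : IsKNSolutionOn Set.univ q r) :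
    IsKNSolutionOn (dtDomain B u v)
      (fun x t => dtPotential B Complex.I (q x t) (u x t) (v x t))
      (fun x t => dtPotential B (-Complex.I) (r x t) (v x t) (u x t)) := by
  refine isKNSolutionOn_of_evolution h.isOpen_dtDomain (h.smooth_dtPotential hqr.smooth_q _) ?_
    ?_ ?_
  · rw [← dtDomain_symm]
    exact h.symm.smooth_dtPotential hqr.smooth_r _
  · exact fun x t hp => h.potential_evolution Complex.I_sq hN hB hqr.smooth_q hqr.smooth_r
      hqr.evolution_fst hqr.evolution_snd hp
  · intro x t hp
    rw [← dtDomain_symm] at hp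
    have := h.symm.potential_evolution (by simp) hN hB hqr.smooth_r hqr.smooth_q
      (by simpa using hqr.evolution_snd) (by simpa [sub_eq_add_neg] using hqr.evolution_fst) hp
    simpa only [neg_neg] using this

theorem isKNSolutionOn_degenerate {N n : ℕ} (hN : 0 < N) {q r : ℝ → ℝ → ℂ}
    (hqr : IsKNSolutionOn Set.univ q r) {S : Set ℂ} {φ ψ : ℝ → ℝ → ℂ → ℂ}
    (hΨ : IsEigenfamily q r S φ ψ) {lam : ℕ → ℂ} (hlam : ∀ j : Fin N, coalesced N n lam j ∈ S)
    (h0 : ∀ j : Fin N, coalesced N n lam j ≠ 0) :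
    IsKNSolutionOn {p | degDetM N n φ ψ lam p.1 p.2 ≠ 0 ∧ degDetP N n φ ψ lam p.1 p.2 ≠ 0}
      (degQ N n q φ ψ lam) (degR N n r φ ψ lam) := by
  have h := hΨ.isMatrixLaxPair hqr.smooth_q hqr.smooth_r hlam
  have hB : (jetShift N n lam).det ≠ 0 := by
    rw [det_jetShift]
    exact Finset.prod_ne_zero_iff.2 fun j _ => h0 j
  have hM : degDetM N n φ ψ lam = fun x t =>
      colMinor (jetShift N n lam) (jet N n lam (φ x t)) (jet N n lam (ψ x t)) 0 := by
    ext x t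
    exact det_degMatrix_entryM hΨ.isOpen hlam (hΨ.holo_fst x t) (hΨ.holo_snd x t)
  have hP : degDetP N n φ ψ lam = fun x t =>
      colMinor (jetShift N n lam) (jet N n lam (ψ x t)) (jet N n lam (φ x t)) 0 := by
    ext x t
    exact det_degMatrix_entryM hΨ.isOpen hlam (hΨ.holo_snd x t) (hΨ.holo_fst x t)
  have hH : degDetH N n φ ψ lam = fun x t =>
      colMinor (jetShift N n lam) (jet N n lam (φ x t)) (jet N n lam (ψ x t)) 1 := by
    ext x t
    exact det_degMatrix_entryH hΨ.isOpen hlam (hΨ.holo_fst x t) (hΨ.holo_snd x t)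
  have hW : degDetW N n φ ψ lam = fun x t =>
      colMinor (jetShift N n lam) (jet N n lam (ψ x t)) (jet N n lam (φ x t)) 1 := by
    ext x t
    exact det_degMatrix_entryH hΨ.isOpen hlam (hΨ.holo_snd x t) (hΨ.holo_fst x t)
  have hR : degR N n r φ ψ lam = fun x t => dtPotential (jetShift N n lam) (-Complex.I) (r x t)
      (jet N n lam (ψ x t)) (jet N n lam (φ x t)) := by
    ext x t
    simp only [degR, dtPotential, hM, hP, hW]
    ring
  have hQ : degQ N n q φ ψ lam = fun x t => dtPotential (jetShift N n lam) Complex.I (q x t)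
      (jet N n lam (φ x t)) (jet N n lam (ψ x t)) := by
    ext x t
    simp only [degQ, dtPotential, hM, hP, hH]
  rw [hQ, hR, hM, hP]
  exact h.isKNSolutionOn hN hB hqr

end

noncomputable section

/-! ### Confluent divided differences -/

section DividedDifference

variable {ι : Type*}

/-- Partial fractions, read off from Lagrange interpolation of the constant `1`. -/
theorem prod_sub_inv_eq_sum_nodalWeight [DecidableEq ι] {s : Finset ι} (hs : s.Nonempty) {v : ι → ℂ}
    (hv : Set.InjOn v s) {z : ℂ} (hz : ∀ i ∈ s, z ≠ v i) :
    (∏ i ∈ s, (z - v i))⁻¹ = ∑ i ∈ s, Lagrange.nodalWeight s v i * (z - v i)⁻¹ := by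
  have h := Lagrange.eval_interpolate_not_at_node (r := fun _ => (1 : ℂ)) hz
  have h1 : Lagrange.interpolate s v (fun _ => (1 : ℂ)) = 1 := Lagrange.interpolate_one hv hs
  rw [h1, Polynomial.eval_one, Lagrange.eval_nodal] at h
  simp only [mul_one] at h
  exact inv_eq_of_mul_eq_one_right h.symm

theorem continuousAt_circleIntegral_prod_inv_mul [Fintype ι] (s : Finset ι) {f : ℂ → ℂ} {a : ℂ} {R : ℝ}
    (hR : 0 < R) (hf : ContinuousOn f (Metric.sphere a R)) {w : ι → ℂ} (hw : ∀ i ∈ s, w i = a) :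
    ContinuousAt (fun v : ι → ℂ => ∮ z in C(a, R), (∏ i ∈ s, (z - v i))⁻¹ • f z) w := by
  obtain ⟨C, hC⟩ := (isCompact_sphere a R).exists_bound_of_continuousOn hf
  have hnear : ∀ᶠ v : ι → ℂ in 𝓝 w, ∀ i ∈ s, v i ∈ Metric.ball a (R / 2) := by
    rw [Filter.eventually_all_finset]
    intro i hi
    have : Tendsto (fun v : ι → ℂ => v i) (𝓝 w) (𝓝 (w i)) := (continuous_apply i).tendsto w
    exact this.eventually (by rw [hw i hi]; exact Metric.ball_mem_nhds a (by positivity))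
  have hdist : ∀ v : ι → ℂ, (∀ i ∈ s, v i ∈ Metric.ball a (R / 2)) → ∀ θ, ∀ i ∈ s,
      R / 2 ≤ ‖circleMap a R θ - v i‖ := by
    intro v hv θ i hi
    have h1 : dist (circleMap a R θ) a = R := circleMap_mem_sphere a hR.le θ
    have h2 : dist (v i) a < R / 2 := hv i hi
    have h3 := dist_triangle (circleMap a R θ) (v i) a
    rw [← dist_eq_norm]
    linarith
  have hfc : Continuous fun θ => f (circleMap a R θ) :=
    hf.comp_continuous (continuous_circleMap a R) fun θ => circleMap_mem_sphere a hR.le θ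
  unfold circleIntegral
  -- Nodes within `R / 2` of the centre stay at distance at least `R / 2` from the circle; `C`
  -- bounds `f` there and the factor `R` comes from `dz`.
  refine intervalIntegral.continuousAt_of_dominated_interval
    (bound := fun _ => R * ((R / 2)⁻¹ ^ s.card * C)) ?_ ?_ ?_ ?_
  · filter_upwards [hnear] with v hv
    refine Continuous.aestronglyMeasurable ?_
    have : Continuous fun θ => (∏ i ∈ s, (circleMap a R θ - v i))⁻¹ := by
      refine Continuous.inv₀ (continuous_finsetProd _ fun i _ =>
        (continuous_circleMap a R).sub continuous_const) fun θ => ?_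
      rw [Finset.prod_ne_zero_iff]
      intro i hi h0
      have := hdist v hv θ i hi
      rw [h0, norm_zero] at this
      linarith
    simp only [deriv_circleMap]
    exact ((continuous_circleMap 0 R).mul continuous_const).smul (this.smul hfc)
  · filter_upwards [hnear] with v hv
    refine Filter.Eventually.of_forall fun θ _ => ?_
    rw [norm_smul, norm_smul, norm_inv, norm_prod, deriv_circleMap]
    have h1 : ‖circleMap 0 R θ * Complex.I‖ = R := by simp [abs_of_pos hR]
    have h2 : ‖f (circleMap a R θ)‖ ≤ C := hC _ (circleMap_mem_sphere a hR.le θ)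
    have h3 : (∏ i ∈ s, ‖circleMap a R θ - v i‖)⁻¹ ≤ (R / 2)⁻¹ ^ s.card := by
      rw [inv_pow]
      refine inv_anti₀ (by positivity) ?_
      rw [← Finset.prod_const]
      exact Finset.prod_le_prod (fun _ _ => by positivity) fun i hi => hdist v hv θ i hi
    rw [h1]
    gcongr
  · exact intervalIntegrable_const
  · refine Filter.Eventually.of_forall fun θ _ => ?_
    suffices h : ContinuousAt (fun v : ι → ℂ => (∏ i ∈ s, (circleMap a R θ - v i))⁻¹) w from
      continuousAt_const.fun_smul (h.fun_smul continuousAt_const)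
    refine ContinuousAt.inv₀ (Continuous.continuousAt (by fun_prop)) ?_
    rw [Finset.prod_ne_zero_iff]
    intro i hi h0
    have := hdist w (fun i hi => by rw [hw i hi]; exact Metric.mem_ball_self (by positivity)) θ i hi
    rw [h0, norm_zero] at this
    linarith

/-- By partial fractions and Cauchy's formula the divided difference is `(2πi)⁻¹ ∮ f(z) / ∏ (z -
v_i) dz`. This integral is continuous in the nodes even where they collide, and there it is Cauchy's
formula for the Taylor coefficient. -/
theorem tendsto_sum_nodalWeight_mul [Fintype ι] [DecidableEq ι] {s : Finset ι} {m : ℕ} (hm : s.card = m + 1) {S : Set ℂ}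
    (hS : IsOpen S) {f : ℂ → ℂ} (hf : DifferentiableOn ℂ f S) {a : ℂ} (ha : a ∈ S) {w : ι → ℂ}
    (hw : ∀ i ∈ s, w i = a) :
    Tendsto (fun v : ι → ℂ => ∑ i ∈ s, Lagrange.nodalWeight s v i * f (v i))
      (𝓝[{v | Set.InjOn v s}] w) (𝓝 (iteratedDeriv m f a / (m.factorial : ℂ))) := by
  obtain ⟨R, hR, hRS⟩ := Metric.nhds_basis_closedBall.mem_iff.1 (hS.mem_nhds ha)
  have hs : s.Nonempty := Finset.card_pos.1 (by omega)
  have hfR : DifferentiableOn ℂ f (Metric.closedBall a R) := hf.mono hRS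
  have hfs : ContinuousOn f (Metric.sphere a R) :=
    hfR.continuousOn.mono Metric.sphere_subset_closedBall
  have h1 := ((continuousAt_circleIntegral_prod_inv_mul s hR hfs hw).tendsto.const_smul
    (2 * Real.pi * Complex.I : ℂ)⁻¹).mono_left (nhdsWithin_le_nhds (s := {v | Set.InjOn v s}))
  have h2 : (2 * Real.pi * Complex.I : ℂ)⁻¹ • (∮ z in C(a, R), (∏ i ∈ s, (z - w i))⁻¹ • f z)
      = iteratedDeriv m f a / (m.factorial : ℂ) := by
    have e : ∀ z, (∏ i ∈ s, (z - w i))⁻¹ = 1 / (z - a) ^ (m + 1) := fun z => by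
      rw [Finset.prod_congr rfl fun i hi => by rw [hw i hi], Finset.prod_const, hm, one_div]
    simp only [e]
    rw [hfR.circleIntegral_one_div_sub_center_pow_smul hR m, smul_smul, smul_eq_mul]
    field_simp
  rw [h2] at h1
  refine h1.congr' ?_
  have hnear : ∀ᶠ v : ι → ℂ in 𝓝 w, ∀ i ∈ s, v i ∈ Metric.ball a R := by
    rw [Filter.eventually_all_finset]
    intro i hi
    have : Tendsto (fun v : ι → ℂ => v i) (𝓝 w) (𝓝 (w i)) := (continuous_apply i).tendsto w
    exact this.eventually (by rw [hw i hi]; exact Metric.ball_mem_nhds a hR)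
  filter_upwards [nhdsWithin_le_nhds hnear, self_mem_nhdsWithin] with v hv hinj
  have hne : ∀ z ∈ Metric.sphere a R, ∀ i ∈ s, z ≠ v i := by
    rintro z hz i hi rfl
    have h3 : dist (v i) a < R := hv i hi
    have h4 : dist (v i) a = R := hz
    linarith
  have e : (∮ z in C(a, R), (∏ i ∈ s, (z - v i))⁻¹ • f z)
      = ∮ z in C(a, R), ∑ i ∈ s, Lagrange.nodalWeight s v i • ((z - v i)⁻¹ • f z) := by
    refine circleIntegral.integral_congr hR.le fun z hz => ?_
    simp only [prod_sub_inv_eq_sum_nodalWeight hs hinj (hne z hz), smul_eq_mul, Finset.sum_mul,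
      mul_assoc]
  have hint : ∀ i ∈ s, CircleIntegrable
      (fun z => Lagrange.nodalWeight s v i • ((z - v i)⁻¹ • f z)) a R := by
    intro i hi
    refine ContinuousOn.circleIntegrable hR.le ?_
    refine continuousOn_const.fun_smul (ContinuousOn.fun_smul ?_ hfs)
    exact (continuousOn_id.sub continuousOn_const).inv₀ fun z hz =>
      sub_ne_zero.2 (hne z hz i hi)
  rw [e, circleIntegral.integral_fun_sum hint, Finset.smul_sum]
  refine Finset.sum_congr rfl fun i hi => ?_
  rw [circleIntegral.integral_smul, hfR.circleIntegral_sub_inv_smul (hv i hi)]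
  simp only [smul_eq_mul]
  field_simp

end DividedDifference

/-! ### The limit of the determinants -/

variable {N : ℕ}

/-- The rows whose parameters enter the divided difference in the row `j`. -/
def jetNodes (N n : ℕ) (j : Fin N) : Finset (Fin N) :=
  if (j : ℕ) + 1 ≤ N - 2 * n then Finset.univ.filter fun l => l ≤ j ∧ (l : ℕ) % 2 = (j : ℕ) % 2
  else {j}

theorem self_mem_jetNodes (n : ℕ) (j : Fin N) : j ∈ jetNodes N n j := by
  unfold jetNodes
  split_ifs <;> simp

theorem le_of_mem_jetNodes {n : ℕ} {j l : Fin N} (h : l ∈ jetNodes N n j) : l ≤ j := by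
  unfold jetNodes at h
  split_ifs at h
  · simp at h
    exact h.1
  · simp at h
    exact h.le

theorem coalesced_of_mem_jetNodes {n : ℕ} (lam : ℕ → ℂ) {j l : Fin N}
    (h : l ∈ jetNodes N n j) : coalesced N n lam l = coalesced N n lam j := by
  unfold jetNodes at h
  split_ifs at h with hj
  · simp only [Finset.mem_filter, Finset.mem_univ, true_and] at h
    obtain ⟨h1, h2⟩ := h
    have h1' : (l : ℕ) ≤ j := h1
    have h3 : Odd ((l : ℕ) + 1) ↔ Odd ((j : ℕ) + 1) := by
      rw [Nat.odd_iff, Nat.odd_iff]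
      omega
    simp [coalesced, hj, show (l : ℕ) + 1 ≤ N - 2 * n by omega, h3]
  · simp at h
    rw [h]

theorem card_jetNodes (n : ℕ) (j : Fin N) : (jetNodes N n j).card = jetOrder N n j + 1 := by
  unfold jetNodes jetOrder
  split_ifs with hj
  · rw [← Finset.card_range ((j : ℕ) / 2 + 1)]
    symm
    refine Finset.card_bij' (fun i hi => (⟨2 * i + (j : ℕ) % 2, by simp at hi; omega⟩ : Fin N))
      (fun l _ => (l : ℕ) / 2) ?_ ?_ ?_ ?_
    · intro i hi
      rw [Finset.mem_range] at hi
      refine Finset.mem_filter.2 ⟨Finset.mem_univ _, Fin.mk_le_of_le_val ?_, ?_⟩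
      · omega
      · dsimp only
        omega
    · intro l hl
      obtain ⟨h1, h2⟩ := (Finset.mem_filter.1 hl).2
      have h1' : (l : ℕ) ≤ j := h1
      rw [Finset.mem_range]
      omega
    · intro i hi
      dsimp only
      omega
    · intro l hl
      obtain ⟨h1, h2⟩ := (Finset.mem_filter.1 hl).2
      ext
      dsimp only
      omega
  · simp

/-- The matrix taking the values at `μ` to the divided differences. -/
def dividedDifferenceMatrix (N n : ℕ) (μ : Fin N → ℂ) : Matrix (Fin N) (Fin N) ℂ :=
  Matrix.of fun j l =>
    if l ∈ jetNodes N n j then Lagrange.nodalWeight (jetNodes N n j) μ l else 0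

theorem det_dividedDifferenceMatrix_ne_zero (n : ℕ) {μ : Fin N → ℂ} (hμ : Function.Injective μ) :
    (dividedDifferenceMatrix N n μ).det ≠ 0 := by
  rw [Matrix.det_of_isLowerTriangular]
  · refine Finset.prod_ne_zero_iff.2 fun j _ => ?_
    simp only [dividedDifferenceMatrix, Matrix.of_apply, self_mem_jetNodes, if_true]
    exact Lagrange.nodalWeight_ne_zero hμ.injOn (self_mem_jetNodes n j)
  · intro j l h
    have h' : j < l := h
    simp only [dividedDifferenceMatrix, Matrix.of_apply]
    exact if_neg fun hl => absurd (le_of_mem_jetNodes hl) (not_le.2 h')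

/-- The product of the two matrices has the divided differences of each column function as entries.
The prefactor does not depend on `e`, so it is common to `M`, `P` and `H`. -/
theorem tendsto_det_fold {n : ℕ} {lam : ℕ → ℂ} {S : Set ℂ} (hS : IsOpen S)
    (hlam : ∀ j : Fin N, coalesced N n lam j ∈ S) {e : ℕ → ℂ → ℂ}
    (he : ∀ k, DifferentiableOn ℂ (e k) S) :
    Tendsto (fun μ => (dividedDifferenceMatrix N n μ).det * (foldMatrix N e μ).det)
      (coalescence N n lam) (𝓝 (degMatrix N n e lam).det) := by
  simp only [← Matrix.det_mul]
  have hdet : Continuous fun A : Matrix (Fin N) (Fin N) ℂ => A.det := continuous_id.matrix_det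
  refine (hdet.tendsto _).comp ?_
  rw [degMatrix_eq]
  refine tendsto_pi_nhds.2 fun j => tendsto_pi_nhds.2 fun k => ?_
  have h := tendsto_sum_nodalWeight_mul (card_jetNodes n j) hS (he (k + 1)) (hlam j)
    fun i hi => coalesced_of_mem_jetNodes lam hi
  refine (h.mono_left (nhdsWithin_mono _ fun μ hμ => hμ.1.injOn)).congr fun μ => ?_
  simp [Matrix.mul_apply, dividedDifferenceMatrix, foldMatrix, Finset.sum_ite_mem]

theorem differentiableOn_entryM {S : Set ℂ} {f g : ℂ → ℂ} (hf : DifferentiableOn ℂ f S)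
    (hg : DifferentiableOn ℂ g S) (k : ℕ) : DifferentiableOn ℂ (entryM N f g k) S := by
  have hp : ∀ m : ℕ, DifferentiableOn ℂ (fun z : ℂ => z ^ m) S := fun m =>
    (differentiable_id.pow m).differentiableOn
  unfold entryM
  by_cases h : Odd k <;> simp only [h, if_true, if_false]
  · exact (hp _).mul hg
  · exact (hp _).mul hf

theorem differentiableOn_entryH {S : Set ℂ} {f g : ℂ → ℂ} (hf : DifferentiableOn ℂ f S)
    (hg : DifferentiableOn ℂ g S) (k : ℕ) : DifferentiableOn ℂ (entryH N f g k) S := by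
  have hp : ∀ m : ℕ, DifferentiableOn ℂ (fun z : ℂ => z ^ m) S := fun m =>
    (differentiable_id.pow m).differentiableOn
  unfold entryH
  by_cases h1 : k = 1 <;> by_cases h : Odd k <;> simp only [h1, h, if_true, if_false]
  · exact (hp _).mul hf
  · exact (hp _).mul hf
  · exact (hp _).mul hg
  · exact (hp _).mul hf

/-- Shows that `|P'| ≠ 0` forces the fixed parameters to be distinct, which is needed both for the
limit to be non-vacuous and for the reflection to permute rows. -/
theorem degDetP_eq_zero_of_row_eq {n : ℕ} {φ ψ : ℝ → ℝ → ℂ → ℂ} {lam : ℕ → ℂ} {x t : ℝ}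
    {i j : Fin N} (hij : i ≠ j) (hi : N - 2 * n < (i : ℕ) + 1) (hj : N - 2 * n < (j : ℕ) + 1)
    (h : lam (i + 1) = lam (j + 1)) : degDetP N n φ ψ lam x t = 0 := by
  refine Matrix.det_zero_of_row_eq hij ?_
  ext k
  simp only [degMatrix, Matrix.of_apply, not_le.2 hi, not_le.2 hj, if_false, h]

theorem coalescence_neBot {n : ℕ} {lam : ℕ → ℂ}
    (h : ∀ i j : Fin N, i ≠ j → N - 2 * n < (i : ℕ) + 1 → N - 2 * n < (j : ℕ) + 1 →
      lam (i + 1) ≠ lam (j + 1)) : (coalescence N n lam).NeBot := by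
  -- A direction of perturbation: distinct nonzero speeds in the movable rows, zero in the fixed
  -- ones. Parameters with equal limits separate for `s ≠ 0`; those with different limits stay apart
  -- for small `s`.
  let δ : Fin N → ℂ := fun j => if (j : ℕ) + 1 ≤ N - 2 * n then (j : ℂ) + 1 else 0
  have key : Tendsto (fun s : ℂ => fun j => coalesced N n lam j + s * δ j) (𝓝[≠] 0)
      (coalescence N n lam) := by
    refine tendsto_nhdsWithin_iff.2 ⟨?_, ?_⟩
    · have : Continuous fun s : ℂ => fun j => coalesced N n lam j + s * δ j := by fun_prop
      have := this.tendsto 0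
      simp only [zero_mul, add_zero] at this
      exact this.mono_left nhdsWithin_le_nhds
    · have hinj : ∀ i j : Fin N, ∀ᶠ s : ℂ in 𝓝[≠] 0,
          coalesced N n lam i + s * δ i = coalesced N n lam j + s * δ j → i = j := by
        intro i j
        by_cases hij : i = j
        · exact Filter.Eventually.of_forall fun _ _ => hij
        by_cases hc : coalesced N n lam i = coalesced N n lam j
        · have hδ : δ i ≠ δ j := by
            simp only [δ]
            split_ifs with h1 h2 h2
            · intro h3
              exact hij (Fin.ext (by exact_mod_cast add_right_cancel h3))
            · exact Nat.cast_add_one_ne_zero _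
            · exact (Nat.cast_add_one_ne_zero _).symm
            · exact absurd (by simpa [coalesced, h1, h2] using hc)
                (h i j hij (not_le.1 h1) (not_le.1 h2))
          filter_upwards [self_mem_nhdsWithin] with s hs hs'
          rw [hc] at hs'
          exact absurd (mul_left_cancel₀ hs (add_left_cancel hs')) hδ
        · have hcont : ContinuousAt (fun s : ℂ => (coalesced N n lam i + s * δ i)
              - (coalesced N n lam j + s * δ j)) 0 := by fun_prop
          have := hcont.eventually (isOpen_ne.mem_nhds
            (show _ ≠ (0 : ℂ) by simpa [sub_eq_zero] using hc))
          filter_upwards [nhdsWithin_le_nhds this] with s hs hs'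
          exact absurd (sub_eq_zero.2 hs') hs
      filter_upwards [Filter.eventually_all.2 fun i => Filter.eventually_all.2 (hinj i)] with s hs
      refine ⟨fun i j => hs i j, fun j hj => ?_⟩
      simp only [coalesced, δ, not_le.2 hj, if_false, mul_zero, add_zero]
  exact key.neBot

theorem limit_degenerate {n : ℕ} {q : ℝ → ℝ → ℂ} {S : Set ℂ} {φ ψ : ℝ → ℝ → ℂ → ℂ}
    (hS : IsOpen S) {lam : ℕ → ℂ} (hlam : ∀ j : Fin N, coalesced N n lam j ∈ S) {x t : ℝ}
    (hφ : DifferentiableOn ℂ (φ x t) S) (hψ : DifferentiableOn ℂ (ψ x t) S)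
    (hP : degDetP N n φ ψ lam x t ≠ 0) :
    (coalescence N n lam).NeBot ∧
      (∀ᶠ μ in coalescence N n lam, (foldMatrix N (entryP N (φ x t) (ψ x t)) μ).det ≠ 0) ∧
      Tendsto (fun μ => foldQ N q φ ψ μ x t) (coalescence N n lam)
        (𝓝 (degQ N n q φ ψ lam x t)) := by
  have tM := tendsto_det_fold hS hlam (differentiableOn_entryM (N := N) hφ hψ)
  have tH := tendsto_det_fold hS hlam (differentiableOn_entryH (N := N) hφ hψ)
  have tP := tendsto_det_fold hS hlam (differentiableOn_entryM (N := N) hψ hφ)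
  refine ⟨coalescence_neBot fun i j hij hi hj h => hP (degDetP_eq_zero_of_row_eq hij hi hj h),
    ?_, ?_⟩
  · filter_upwards [tP.eventually_ne hP] with μ hμ
    exact right_ne_zero_of_mul hμ
  · have hlim := (((tM.pow 2).div (tP.pow 2) (pow_ne_zero 2 hP)).mul_const (q x t)).add
      (((tM.mul tH).const_mul (2 * Complex.I)).div (tP.pow 2) (pow_ne_zero 2 hP))
    refine hlim.congr' ?_
    filter_upwards [self_mem_nhdsWithin] with μ hμ
    -- Injectivity of `μ` makes the prefactor nonzero; it occurs squared in every numerator and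
    -- denominator and cancels.
    have hd := pow_ne_zero 2 (det_dividedDifferenceMatrix_ne_zero n hμ.1)
    simp only [foldQ, entryP_eq, Pi.div_apply]
    rw [mul_pow, mul_pow, mul_div_mul_left _ _ hd,
      mul_mul_mul_comm _ (foldMatrix N (entryM N (φ x t) (ψ x t)) μ).det, ← pow_two,
      mul_left_comm (2 * Complex.I), mul_div_mul_left _ _ hd]

end

noncomputable section

/-! ### The derivative nonlinear Schrödinger reduction -/

theorem iteratedDeriv_conj_neg_conj (f : ℂ → ℂ) (m : ℕ) (a : ℂ) :
    iteratedDeriv m (fun z => conj (f (-conj z))) a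
      = (-1) ^ m * conj (iteratedDeriv m f (-conj a)) := by
  induction m generalizing a with
  | zero => simp
  | succ m ih =>
    have e : iteratedDeriv m (fun z => conj (f (-conj z)))
        = fun a => (-1) ^ m * (conj ∘ (fun z => iteratedDeriv m f (-z)) ∘ conj) a := by
      ext a
      exact ih a
    rw [iteratedDeriv_succ, e, deriv_const_mul_field, deriv_conj_conj]
    simp only [Function.comp_apply, deriv_comp_neg, ← iteratedDeriv_succ]
    simp [pow_succ]

variable {N : ℕ}

/-- For even `N` the first `N - 2n` rows split into pairs with parameters `λ_1`, `λ_2` and equal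
order, which are swapped. On the fixed rows, invariance gives a map that is injective because the
parameters are distinct. -/
theorem exists_reflection {n : ℕ} {lam : ℕ → ℂ} (hN : Even N)
    (h12 : lam 2 = -conj (lam 1))
    (hinv : ∀ j, N - 2 * n < j → j ≤ N → ∃ k, N - 2 * n < k ∧ k ≤ N ∧ lam k = -conj (lam j))
    (hinj : ∀ i j : Fin N, i ≠ j → N - 2 * n < (i : ℕ) + 1 → N - 2 * n < (j : ℕ) + 1 →
      lam (i + 1) ≠ lam (j + 1)) :
    ∃ τ : Equiv.Perm (Fin N), ∀ j, coalesced N n lam (τ j) = -conj (coalesced N n lam j) ∧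
      jetOrder N n (τ j) = jetOrder N n j := by
  have hN2 : N % 2 = 0 := Nat.even_iff.1 hN
  have hex : ∀ j : Fin N, ∃ l : Fin N,
      ((j : ℕ) + 1 ≤ N - 2 * n →
        ((j : ℕ) % 2 = 0 ∧ (l : ℕ) = j + 1) ∨ ((j : ℕ) % 2 = 1 ∧ (l : ℕ) + 1 = j)) ∧
      (N - 2 * n < (j : ℕ) + 1 → N - 2 * n < (l : ℕ) + 1 ∧
        lam (l + 1) = -conj (lam (j + 1))) := by
    intro j
    rcases le_or_gt ((j : ℕ) + 1) (N - 2 * n) with hj | hj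
    · by_cases h2 : (j : ℕ) % 2 = 0
      · exact ⟨⟨j + 1, by omega⟩, fun _ => Or.inl ⟨h2, rfl⟩, fun h => by omega⟩
      · exact ⟨⟨j - 1, by omega⟩, fun _ => Or.inr ⟨by omega, by dsimp only; omega⟩,
          fun h => by omega⟩
    · obtain ⟨k, hk1, hk2, hk⟩ := hinv (j + 1) hj j.2
      obtain ⟨l, rfl⟩ : ∃ l, k = l + 1 := ⟨k - 1, by omega⟩
      exact ⟨⟨l, hk2⟩, fun h => by omega, fun _ => ⟨hk1, hk⟩⟩
  choose σ hσ1 hσ2 using hex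
  have hσ : Function.Injective σ := by
    intro i j hij
    rcases le_or_gt ((i : ℕ) + 1) (N - 2 * n) with hi | hi <;>
      rcases le_or_gt ((j : ℕ) + 1) (N - 2 * n) with hj | hj
    · have h1 := hσ1 i hi
      have h2 := hσ1 j hj
      rw [hij] at h1
      ext
      omega
    · have h1 := hσ1 i hi
      have h2 := (hσ2 j hj).1
      rw [hij] at h1
      omega
    · have h1 := (hσ2 i hi).1
      have h2 := hσ1 j hj
      rw [hij] at h1
      omega
    · by_contra hne
      have h1 := (hσ2 i hi).2
      rw [hij, (hσ2 j hj).2] at h1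
      exact hinj i j hne hi hj (star_injective (neg_injective h1)).symm
  refine ⟨Equiv.ofBijective σ (Finite.injective_iff_bijective.1 hσ), fun j => ?_⟩
  rw [Equiv.ofBijective_apply]
  rcases le_or_gt ((j : ℕ) + 1) (N - 2 * n) with hj | hj
  · have h1 := hσ1 j hj
    have hl : (σ j : ℕ) + 1 ≤ N - 2 * n := by omega
    refine ⟨?_, ?_⟩
    · simp only [coalesced, hj, hl, if_true, Nat.odd_iff]
      rcases h1 with ⟨h3, h4⟩ | ⟨h3, h4⟩
      · rw [if_neg (by omega), if_pos (by omega), h12]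
      · rw [if_pos (by omega), if_neg (by omega), h12]
        simp
    · simp only [jetOrder, hj, hl, if_true]
      omega
  · obtain ⟨h1, h2⟩ := hσ2 j hj
    exact ⟨by simp only [coalesced, not_le.2 hj, not_le.2 h1, if_false, h2],
      by simp only [jetOrder, not_le.2 hj, not_le.2 h1, if_false]⟩

theorem jet_reflection {n : ℕ} {lam : ℕ → ℂ} {S : Set ℂ} (hS : IsOpen S)
    (hlam : ∀ j : Fin N, coalesced N n lam j ∈ S) {τ : Equiv.Perm (Fin N)}
    (hτ : ∀ j, coalesced N n lam (τ j) = -conj (coalesced N n lam j) ∧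
      jetOrder N n (τ j) = jetOrder N n j) {f g : ℂ → ℂ} {s : ℂ}
    (h : ∀ z ∈ S, g z = s * conj (f (-conj z))) (j : Fin N) :
    jet N n lam g j = (-1) ^ jetOrder N n j * (s * conj (jet N n lam f (τ j))) := by
  have e : g =ᶠ[𝓝 (coalesced N n lam j)] fun z => s * conj (f (-conj z)) :=
    Filter.eventuallyEq_of_mem (hS.mem_nhds (hlam j)) h
  simp only [jet]
  rw [e.iteratedDeriv_eq, iteratedDeriv_const_mul_field, iteratedDeriv_conj_neg_conj, (hτ j).1,
    (hτ j).2, map_div₀, Complex.conj_natCast]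
  ring

/-- Each row acquires the sign `(-1)^m` from differentiating `m` times through the reflection, the
rows are permuted by `τ`, and each column carries its factor `s`. -/
theorem det_degMatrix_reflection {n : ℕ} {lam : ℕ → ℂ} {S : Set ℂ} (hS : IsOpen S)
    (hlam : ∀ j : Fin N, coalesced N n lam j ∈ S) {τ : Equiv.Perm (Fin N)}
    (hτ : ∀ j, coalesced N n lam (τ j) = -conj (coalesced N n lam j) ∧
      jetOrder N n (τ j) = jetOrder N n j) {e e' : ℕ → ℂ → ℂ} (s : ℕ → ℂ)
    (h : ∀ k, ∀ z ∈ S, e' k z = s k * conj (e k (-conj z))) :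
    (degMatrix N n e' lam).det = (∏ j, (-1) ^ jetOrder N n j) * (Equiv.Perm.sign τ : ℤ)
      * (∏ k : Fin N, s (k + 1)) * conj (degMatrix N n e lam).det := by
  let A : Matrix (Fin N) (Fin N) ℂ := ((degMatrix N n e lam).map conj).submatrix τ id
  let A' : Matrix (Fin N) (Fin N) ℂ := Matrix.of fun j k => s (k + 1) * A j k
  have h1 : degMatrix N n e' lam = Matrix.of fun j k => (-1) ^ jetOrder N n j * A' j k := by
    ext j k
    rw [degMatrix_eq]
    refine (jet_reflection hS hlam hτ (h (k + 1)) j).trans ?_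
    simp [A', A, degMatrix_eq]
  have h2 : A.det = (Equiv.Perm.sign τ : ℤ) * conj (degMatrix N n e lam).det := by
    rw [Matrix.det_permute, RingHom.map_det]
    rfl
  have h3 : A'.det = (∏ k : Fin N, s (k + 1)) * A.det :=
    Matrix.det_mul_row (fun k : Fin N => s (k + 1)) A
  rw [h1, Matrix.det_mul_column, h3, h2]
  ring

theorem entryM_reflection {S : Set ℂ} {f g : ℂ → ℂ} (hf : ∀ z ∈ S, f z = conj (g (-conj z)))
    (hg : ∀ z ∈ S, g z = conj (f (-conj z))) (k : ℕ) :
    ∀ z ∈ S, entryM N f g k z = (-1) ^ (N - k) * conj (entryM N g f k (-conj z)) := by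
  intro z hz
  have e : (-1 : ℂ) ^ (N - k) * (-z) ^ (N - k) = z ^ (N - k) := by
    rw [← mul_pow, neg_one_mul, neg_neg]
  by_cases h : Odd k <;> simp only [entryM, h, if_true, if_false, map_mul, map_pow, map_neg,
    Complex.conj_conj, ← mul_assoc, e]
  · rw [hg z hz]
  · rw [hf z hz]

/-- The first column has the power `λ^N` instead of `λ^(N-1)`, hence one sign more than for `M`;
this becomes the relative sign between `|M'|` and `|H'|` under conjugation. -/
theorem entryH_reflection {S : Set ℂ} {f g : ℂ → ℂ} (hf : ∀ z ∈ S, f z = conj (g (-conj z)))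
    (hg : ∀ z ∈ S, g z = conj (f (-conj z))) (hN : 0 < N) (k : ℕ) :
    ∀ z ∈ S, entryH N f g k z
      = ((if k = 1 then -1 else 1) * (-1) ^ (N - k)) * conj (entryH N g f k (-conj z)) := by
  intro z hz
  have e : ∀ m : ℕ, (-1 : ℂ) ^ m * (-z) ^ m = z ^ m := fun m => by
    rw [← mul_pow, neg_one_mul, neg_neg]
  by_cases h1 : k = 1
  · simp only [entryH, h1, if_true, map_mul, map_pow, map_neg, Complex.conj_conj]
    rw [← pow_succ', Nat.sub_add_cancel hN, ← mul_assoc, e, hf z hz]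
  by_cases h : Odd k <;> simp only [entryH, h1, h, if_true, if_false, map_mul, map_pow, map_neg,
    Complex.conj_conj, one_mul, ← mul_assoc, e]
  · rw [hg z hz]
  · rw [hf z hz]

theorem degDet_reflection {n : ℕ} {lam : ℕ → ℂ} {S : Set ℂ} (hS : IsOpen S) (hN : 0 < N)
    (hlam : ∀ j : Fin N, coalesced N n lam j ∈ S) {τ : Equiv.Perm (Fin N)}
    (hτ : ∀ j, coalesced N n lam (τ j) = -conj (coalesced N n lam j) ∧
      jetOrder N n (τ j) = jetOrder N n j) :
    ∃ K : ℂ, K ^ 2 = 1 ∧ ∀ f g : ℂ → ℂ, (∀ z ∈ S, f z = conj (g (-conj z))) →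
      (∀ z ∈ S, g z = conj (f (-conj z))) →
      conj (degMatrix N n (entryM N g f) lam).det = K * (degMatrix N n (entryM N f g) lam).det ∧
      conj (degMatrix N n (entryH N g f) lam).det
        = -(K * (degMatrix N n (entryH N f g) lam).det) := by
  have hone : (∏ k : Fin N, (if (k : ℕ) + 1 = 1 then -1 else 1 : ℂ)) = -1 := by
    obtain ⟨m, rfl⟩ : ∃ m, N = m + 1 := ⟨N - 1, by omega⟩
    rw [Fin.prod_univ_succ]
    simp
  let K : ℂ := (∏ j, (-1) ^ jetOrder N n j) * (Equiv.Perm.sign τ : ℤ)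
    * (∏ k : Fin N, (-1) ^ (N - ((k : ℕ) + 1)))
  have hsq : ∀ k : ℕ, ((-1 : ℂ) ^ k) ^ 2 = 1 := fun k => by
    rw [← pow_mul, mul_comm, pow_mul, neg_one_sq, one_pow]
  have hK : K ^ 2 = 1 := by
    have h1 : ((Equiv.Perm.sign τ : ℤ) : ℂ) ^ 2 = 1 := by
      rcases Int.units_eq_one_or (Equiv.Perm.sign τ) with h | h <;> simp [h]
    simp only [K, mul_pow, ← Finset.prod_pow, hsq, h1, Finset.prod_const_one, mul_one]
  refine ⟨K, hK, fun f g hf hg => ⟨?_, ?_⟩⟩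
  · rw [det_degMatrix_reflection hS hlam hτ (e' := entryM N f g) (e := entryM N g f) _
      (entryM_reflection hf hg)]
    change _ = K * (K * _)
    rw [← mul_assoc, ← pow_two, hK, one_mul]
  · have hprod : (∏ k : Fin N, ((if (k : ℕ) + 1 = 1 then -1 else 1 : ℂ)
        * (-1) ^ (N - ((k : ℕ) + 1)))) = -∏ k : Fin N, (-1) ^ (N - ((k : ℕ) + 1)) := by
      rw [Finset.prod_mul_distrib, hone, neg_one_mul]
    rw [det_degMatrix_reflection hS hlam hτ (e' := entryH N f g) (e := entryH N g f) _
      (entryH_reflection hf hg hN), hprod]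
    linear_combination (-conj (degMatrix N n (entryH N g f) lam).det) * hK

/-- Conjugation gives `|P'|^* = K|M'|`, `|M'|^* = K|P'|` and `|H'|^* = -K|W'|` with `K² = 1`.
Substituted into the conjugate of `q_N`, these yield `-r_N`, since `K` enters only through ratios of
squares. -/
theorem degR_eq_neg_conj_degQ {n : ℕ} {q r : ℝ → ℝ → ℂ} {φ ψ : ℝ → ℝ → ℂ → ℂ} {lam : ℕ → ℂ}
    {S : Set ℂ} (hS : IsOpen S) (hN0 : 0 < N) (hN : Even N)
    (hlam : ∀ j : Fin N, coalesced N n lam j ∈ S) (hr : ∀ x t, r x t = -conj (q x t))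
    (hsym : ∀ z ∈ S, -conj z ∈ S ∧ ∀ x t, conj (φ x t (-conj z)) = ψ x t z)
    (h12 : lam 2 = -conj (lam 1))
    (hinv : ∀ j, N - 2 * n < j → j ≤ N → ∃ k, N - 2 * n < k ∧ k ≤ N ∧ lam k = -conj (lam j))
    {x t : ℝ} (hP : degDetP N n φ ψ lam x t ≠ 0) :
    degDetM N n φ ψ lam x t ≠ 0 ∧
      degR N n r φ ψ lam x t = -conj (degQ N n q φ ψ lam x t) := by
  obtain ⟨τ, hτ⟩ := exists_reflection hN h12 hinv
    fun i j hij hi hj h => hP (degDetP_eq_zero_of_row_eq hij hi hj h)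
  obtain ⟨K, hK, h⟩ := degDet_reflection hS hN0 hlam hτ
  have hψ : ∀ z ∈ S, ψ x t z = conj (φ x t (-conj z)) := fun z hz => ((hsym z hz).2 x t).symm
  have hφ : ∀ z ∈ S, φ x t z = conj (ψ x t (-conj z)) := fun z hz => by
    rw [← (hsym _ (hsym z hz).1).2 x t]
    simp
  have hK0 : K ≠ 0 := fun h0 => by simp [h0] at hK
  have cP : conj (degDetP N n φ ψ lam x t) = K * degDetM N n φ ψ lam x t := (h _ _ hφ hψ).1
  have cM : conj (degDetM N n φ ψ lam x t) = K * degDetP N n φ ψ lam x t := (h _ _ hψ hφ).1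
  have cH : conj (degDetH N n φ ψ lam x t) = -(K * degDetW N n φ ψ lam x t) := (h _ _ hψ hφ).2
  have hM : degDetM N n φ ψ lam x t ≠ 0 := fun h0 => by
    rw [h0, mul_zero, map_eq_zero] at cP
    exact hP cP
  refine ⟨hM, ?_⟩
  simp only [degQ, degR, map_add, map_mul, map_div₀, map_pow, cP, cM, cH, Complex.conj_I,
    Complex.conj_ofNat, hr]
  field_simp
  ring

theorem IsKNSolutionOn.isDNLSSolutionOn {D : Set (ℝ × ℝ)} {q r : ℝ → ℝ → ℂ}
    (h : IsKNSolutionOn D q r) (hr : ∀ x t, (x, t) ∈ D → r x t = -conj (q x t)) :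
    IsDNLSSolutionOn D q where
  isOpen := h.isOpen
  smooth := h.smooth_q
  eq x t hp := by
    have e : dX (fun y s => q y s ^ 2 * r y s) x t
        = -dX (fun y s => q y s ^ 2 * conj (q y s)) x t := by
      rw [dX_congr (g := fun y s => -(q y s ^ 2 * conj (q y s))) h.isOpen
        (fun x t hp => by rw [hr x t hp, mul_neg]) hp]
      exact deriv.fun_neg
    rw [← h.eq_q x t hp, e]
    ring

end

/-! ### The three parts combined. -/

theorem theorem2 (N n : ℕ) (hn : 2 * n < N)
    (q r : ℝ → ℝ → ℂ) (hqr : IsKNSolutionOn Set.univ q r)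
    (S : Set ℂ) (φ ψ : ℝ → ℝ → ℂ → ℂ) (hΨ : IsEigenfamily q r S φ ψ)
    (lam : ℕ → ℂ) (hlam : ∀ j : Fin N, coalesced N n lam j ∈ S) :
    -- the limit of the `N`-fold formula
    (∀ x t : ℝ, degDetP N n φ ψ lam x t ≠ 0 →
      (coalescence N n lam).NeBot ∧
      (∀ᶠ μ in coalescence N n lam,
        (foldMatrix N (entryP N (φ x t) (ψ x t)) μ).det ≠ 0) ∧
      Tendsto (fun μ => foldQ N q φ ψ μ x t) (coalescence N n lam)
        (𝓝 (degQ N n q φ ψ lam x t))) ∧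
    -- the limit is a Darboux transformation of the Kaup–Newell system
    ((∀ j : Fin N, coalesced N n lam j ≠ 0) →
      IsKNSolutionOn {p | degDetM N n φ ψ lam p.1 p.2 ≠ 0 ∧ degDetP N n φ ψ lam p.1 p.2 ≠ 0}
        (degQ N n q φ ψ lam) (degR N n r φ ψ lam)) ∧
    -- and, under the reduction `r = -q^*`, of the derivative nonlinear Schrödinger equation
    ((∀ j : Fin N, coalesced N n lam j ≠ 0) → Even N →
      (∀ x t, r x t = -conj (q x t)) →
      (∀ z ∈ S, -conj z ∈ S ∧ ∀ x t, conj (φ x t (-conj z)) = ψ x t z) →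
      lam 2 = -conj (lam 1) →
      (∀ j, N - 2 * n < j → j ≤ N → ∃ k, N - 2 * n < k ∧ k ≤ N ∧ lam k = -conj (lam j)) →
      (∀ x t, degDetP N n φ ψ lam x t ≠ 0 → degDetM N n φ ψ lam x t ≠ 0 ∧
        degR N n r φ ψ lam x t = -conj (degQ N n q φ ψ lam x t)) ∧
      IsDNLSSolutionOn {p | degDetP N n φ ψ lam p.1 p.2 ≠ 0} (degQ N n q φ ψ lam)) := by
  have hN : 0 < N := by omega
  refine ⟨fun x t hP => limit_degenerate hΨ.isOpen hlam (hΨ.holo_fst x t) (hΨ.holo_snd x t) hP,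
    fun h0 => isKNSolutionOn_degenerate hN hqr hΨ hlam h0, fun h0 hE hr hsym h12 hinv => ?_⟩
  have key := fun x t hP => degR_eq_neg_conj_degQ (x := x) (t := t) hΨ.isOpen hN hE hlam hr hsym
    h12 hinv hP
  refine ⟨key, ?_⟩
  -- Under the reduction `|M'|` cannot vanish where `|P'|` does not, so the domain of the
  -- Kaup–Newell solution is all of `|P'| ≠ 0`.
  have hD : {p : ℝ × ℝ | degDetP N n φ ψ lam p.1 p.2 ≠ 0}
      = {p | degDetM N n φ ψ lam p.1 p.2 ≠ 0 ∧ degDetP N n φ ψ lam p.1 p.2 ≠ 0} := by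
    ext p
    exact ⟨fun hp => ⟨(key _ _ hp).1, hp⟩, fun hp => hp.2⟩
  rw [hD]
  exact (isKNSolutionOn_degenerate hN hqr hΨ hlam h0).isDNLSSolutionOn
    fun x t hp => (key x t hp.2).2
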